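/- Let $M>0$ and $l\in\{0,1,2,\dots\}$. Let $r\in(2M,\infty)$ be the function of the Regge–Wheeler coordinate $u\in\mathbb R$ given by $u=r+2M\log\left(\frac r{2M}-1\right)$, and let $$V_l(u)=\Big(1-\frac{2M}{r}\Big)\Big(\frac{2M}{r^3}+\frac{l(l+1)}{r^2}\Big).$$ Let $H^1_{V_l}(\mathbb R)$ be the space of functions $\psi:\mathbb R\to\mathbb C$ with weak derivative $\psi'\in L^2(\mathbb R)$ and $V_l^{1/2}\psi\in L^2(\mathbb R)$, with scalar product $(\psi',\phi')_{L^2}+(V_l\psi,\phi)_{L^2}$, let $H^1_{V_l,0}(\mathbb R)$ be the closure of $C_0^\infty(\mathbb R)$ in it, and let $\mathcal H=H^1_{V_l,0}(\mathbb R)\oplus L^2(\mathbb R)$, with the energy scalar product $$\langle\Psi,\Phi\rangle=\int_{\mathbb R}\big(\overline{\psi_2}\phi_2+\overline{\psi_1'}\phi_1'+V_l\overline{\psi_1}\phi_1\big)\,du .$$ Let $H$ be the closure in $\mathcal H$ of the operator $(\psi_1,\psi_2)\mapsto(\psi_2,\,-\psi_1''+V_l\psi_1)$ with domain $C_0^\infty(\mathbb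 R)^2$. Let $\omega\in\mathbb C\setminus\mathbb R$, and put $\kappa=i\omega$ if $\operatorname{Im}\omega>0$ and $\kappa=-i\omega$ if $\operatorname{Im}\omega<0$. Then the equation $-\phi''+(V_l-\omega^2)\phi=0$ on $\mathbb R$ has a unique solution $\acute\phi_\omega$ with $e^{\kappa u}\acute\phi_\omega(u)\to1$ and $(e^{\kappa u}\acute\phi_\omega(u))'\to0$ as $u\to-\infty$, and a unique solution $\grave\phi_\omega$ with $e^{-\kappa u}\grave\phi_\omega(u)\to1$ and $(e^{-\kappa u}\grave\phi_\omega(u))'\to0$ as $u\to+\infty$ (the Jost solutions). Their Wronskian $w=\acute\phi_\omega\grave\phi_\omega'-\acute\phi_\omega'\grave\phi_\omega$ is a non-zero constant. Let $$s_\omega(u,v)=-\frac1w\begin{cases}\acute\phi_\omega(u)\grave\phi_\omega(v),&u\le v,\\ \acute\phi_\omega(v)\grave\phi_\omega(u),&u>v.\end{cases}$$ The resolvent $(H-\omega)^{-1}:\mathcal H\to\mathcal H$ exists as a bounded operator defined on all of $\mathcal H$, and it is the integral operator with kernel $$k_\omega(u,v)=\delta(u-v)\begin{pmatrix}0&0\\1&0\end{pmatrix}+s_\omega(u,v)\begin{pmatrix}\omega&1\\\omega^2&\omega\end{pmatrix};$$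 that is, for every $\Psi=(\psi_1,\psi_2)^T\in\mathcal H$ the following integral converges absolutely for every $u\in\mathbb R$, and for almost every $u$ $$\big((H-\omega)^{-1}\Psi\big)(u)=\begin{pmatrix}0\\\psi_1(u)\end{pmatrix}+\int_{\mathbb R}s_\omega(u,v)\begin{pmatrix}\omega&1\\\omega^2&\omega\end{pmatrix}\Psi(v)\,dv .$$ -/

import Mathlib

open MeasureTheory Filter Topology Set
open scoped ENNReal Matrix

noncomputable section

namespace Schwarzschild

/-! ### Radial variable and potential -/

/-- The Regge-Wheeler coordinate `u(r) = r + 2M log (r / (2M) - 1)`, for `r > 2M`. -/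
def reggeWheeler (M r : ℝ) : ℝ := r + 2 * M * Real.log (r / (2 * M) - 1)

/-- The radius `r ∈ (2M, ∞)` as a function of the Regge-Wheeler coordinate `u ∈ ℝ`: the inverse
of the bijection `reggeWheeler M : (2M, ∞) → ℝ`. -/
def radius (M u : ℝ) : ℝ := Function.invFunOn (reggeWheeler M) (Ioi (2 * M)) u

/-- The potential `V_l(u) = (1 - 2M/r) (2M/r³ + l(l+1)/r²)`, with `r = r(u)`. -/
def potential (M : ℝ) (l : ℕ) (u : ℝ) : ℝ :=
  (1 - 2 * M / radius M u) *
    (2 * M / radius M u ^ 3 + (l : ℝ) * ((l : ℝ) + 1) / radius M u ^ 2)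

theorem reggeWheeler_surjOn {M : ℝ} (hM : 0 < M) (u : ℝ) :
    ∃ r ∈ Ioi (2 * M), reggeWheeler M r = u := by
  have hs : Function.Surjective (fun x : ℝ => Real.exp x + x) := by
    apply Continuous.surjective (by fun_prop)
    · exact Real.tendsto_exp_atTop.atTop_add_atTop tendsto_id
    · exact tendsto_atBot_mono' _
        ((eventually_le_atBot (0 : ℝ)).mono fun x hx => by
          have := Real.exp_le_one_iff.mpr hx
          show Real.exp x + x ≤ 1 + x
          linarith)
        (tendsto_atBot_add_const_left _ 1 tendsto_id)
  obtain ⟨x, hx⟩ := hs (u / (2 * M) - 1)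
  refine ⟨2 * M * (1 + Real.exp x), ?_, ?_⟩
  · have := Real.exp_pos x
    show 2 * M < _
    nlinarith
  · have h1 : 2 * M * (1 + Real.exp x) / (2 * M) - 1 = Real.exp x := by
      field_simp; ring
    simp only at hx
    rw [reggeWheeler, h1, Real.log_exp]
    have : u = 2 * M * (Real.exp x + x + 1) := by
      rw [hx]; field_simp; ring
    rw [this]; ring

theorem radius_gt {M : ℝ} (hM : 0 < M) (u : ℝ) : 2 * M < radius M u :=
  Function.invFunOn_mem (reggeWheeler_surjOn hM u)

theorem reggeWheeler_radius {M : ℝ} (hM : 0 < M) (u : ℝ) : reggeWheeler M (radius M u) = u :=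
  Function.invFunOn_eq (reggeWheeler_surjOn hM u)

theorem reggeWheeler_strictMonoOn {M : ℝ} (hM : 0 < M) :
    StrictMonoOn (reggeWheeler M) (Ioi (2 * M)) := by
  intro a ha b _ hab
  have ha' : 2 * M < a := ha
  have h1 : 0 < a / (2 * M) - 1 := by
    rw [sub_pos, lt_div_iff₀ (by positivity)]; linarith
  have h2 : a / (2 * M) - 1 < b / (2 * M) - 1 := by gcongr
  have := Real.log_lt_log h1 h2
  have h3 : 2 * M * Real.log (a / (2 * M) - 1) < 2 * M * Real.log (b / (2 * M) - 1) := by gcongr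
  unfold reggeWheeler
  linarith

theorem radius_monotone {M : ℝ} (hM : 0 < M) : Monotone (radius M) := by
  intro u v huv
  by_contra! h
  have := reggeWheeler_strictMonoOn hM (radius_gt hM v) (radius_gt hM u) h
  rw [reggeWheeler_radius hM, reggeWheeler_radius hM] at this
  linarith

theorem measurable_potential {M : ℝ} (hM : 0 < M) (l : ℕ) : Measurable (potential M l) := by
  have := (radius_monotone hM).measurable
  unfold potential
  fun_prop

theorem potential_pos {M : ℝ} (hM : 0 < M) (l : ℕ) (u : ℝ) : 0 < potential M l u := by
  have h := radius_gt hM u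
  have hr : 0 < radius M u := by linarith
  have h1 : 0 < 1 - 2 * M / radius M u := by
    rw [sub_pos, div_lt_one hr]; exact h
  unfold potential
  positivity

/-- An upper bound for the potential. -/
def potentialBound (M : ℝ) (l : ℕ) : ℝ :=
  2 * M / (2 * M) ^ 3 + (l : ℝ) * ((l : ℝ) + 1) / (2 * M) ^ 2

theorem potential_le {M : ℝ} (hM : 0 < M) (l : ℕ) (u : ℝ) :
    potential M l u ≤ potentialBound M l := by
  have h := radius_gt hM u
  have hr : 0 < radius M u := by linarith
  have h1 : 1 - 2 * M / radius M u ≤ 1 := by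
    have : 0 < 2 * M / radius M u := by positivity
    linarith
  unfold potential potentialBound
  calc _ ≤ 1 * (2 * M / radius M u ^ 3 + (l : ℝ) * ((l : ℝ) + 1) / radius M u ^ 2) := by
        gcongr
    _ ≤ _ := by
        rw [one_mul]
        gcongr

/-! ### Test functions and weak derivatives -/

/-- `C_0^∞(ℝ)`: the smooth, compactly supported functions `ℝ → ℂ`. -/
def testFun : Submodule ℂ (ℝ → ℂ) where
  carrier := {f | ContDiff ℝ (⊤ : ℕ∞) f ∧ HasCompactSupport f}
  add_mem' hf hg := ⟨hf.1.add hg.1, hf.2.add hg.2⟩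
  zero_mem' := ⟨contDiff_const, HasCompactSupport.zero⟩
  smul_mem' c _ hf := ⟨contDiff_const.smul hf.1, hf.2.smul_left (f := fun _ => c)⟩

theorem testFun_deriv {f : ℝ → ℂ} (hf : f ∈ testFun) : deriv f ∈ testFun :=
  ⟨(contDiff_infty_iff_deriv.mp hf.1).2, hf.2.deriv⟩

theorem testFun_differentiable {f : ℝ → ℂ} (hf : f ∈ testFun) : Differentiable ℝ f :=
  (contDiff_infty_iff_deriv.mp hf.1).1

theorem testFun_memLp {f : ℝ → ℂ} (hf : f ∈ testFun) : MemLp f 2 (volume : Measure ℝ) :=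
  hf.1.continuous.memLp_of_hasCompactSupport hf.2

theorem testFun_integrable_mul {f η : ℝ → ℂ} (hf : LocallyIntegrable f) (hη : η ∈ testFun) :
    Integrable fun u => f u * η u := by
  have := hf.integrable_smul_left_of_hasCompactSupport hη.1.continuous hη.2
  simpa [mul_comm] using this

/-- `g` is the weak (distributional) derivative of the locally integrable function `f` on `ℝ`. -/
def HasWeakDeriv (f g : ℝ → ℂ) : Prop :=
  LocallyIntegrable f ∧ LocallyIntegrable g ∧
    ∀ η ∈ testFun, ∫ u, f u * deriv η u = -∫ u, g u * η u

theorem HasWeakDeriv.congr {f g f₁ g₁ : ℝ → ℂ} (h : HasWeakDeriv f g)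
    (hf : f₁ =ᵐ[volume] f) (hg : g₁ =ᵐ[volume] g) : HasWeakDeriv f₁ g₁ := by
  refine ⟨h.1.congr hf.symm, h.2.1.congr hg.symm, fun η hη => ?_⟩
  have e1 : ∫ u, f₁ u * deriv η u = ∫ u, f u * deriv η u :=
    integral_congr_ae (hf.mono fun u hu => by simp only [hu])
  have e2 : ∫ u, g₁ u * η u = ∫ u, g u * η u :=
    integral_congr_ae (hg.mono fun u hu => by simp only [hu])
  rw [e1, e2]
  exact h.2.2 η hη

theorem HasWeakDeriv.add {f g f₁ g₁ : ℝ → ℂ} (h : HasWeakDeriv f g) (h₁ : HasWeakDeriv f₁ g₁) :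
    HasWeakDeriv (f + f₁) (g + g₁) := by
  refine ⟨h.1.add h₁.1, h.2.1.add h₁.2.1, fun η hη => ?_⟩
  simp only [Pi.add_apply, add_mul]
  rw [integral_add (testFun_integrable_mul h.1 (testFun_deriv hη))
      (testFun_integrable_mul h₁.1 (testFun_deriv hη)),
    integral_add (testFun_integrable_mul h.2.1 hη) (testFun_integrable_mul h₁.2.1 hη),
    h.2.2 η hη, h₁.2.2 η hη]
  ring

theorem HasWeakDeriv.smul {f g : ℝ → ℂ} (c : ℂ) (h : HasWeakDeriv f g) :
    HasWeakDeriv (c • f) (c • g) := by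
  refine ⟨h.1.smul c, h.2.1.smul c, fun η hη => ?_⟩
  simp only [Pi.smul_apply, smul_eq_mul, mul_assoc]
  rw [integral_const_mul, integral_const_mul, h.2.2 η hη]
  ring

theorem HasWeakDeriv.zero : HasWeakDeriv 0 0 :=
  ⟨locallyIntegrable_zero, locallyIntegrable_zero, fun η _ => by simp⟩

theorem testFun_hasWeakDeriv {f : ℝ → ℂ} (hf : f ∈ testFun) : HasWeakDeriv f (deriv f) := by
  have hd := testFun_deriv hf
  refine ⟨hf.1.continuous.locallyIntegrable, hd.1.continuous.locallyIntegrable, fun η hη => ?_⟩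
  refine integral_mul_deriv_eq_deriv_mul_of_integrable
    (fun x _ => (testFun_differentiable hf x).hasDerivAt)
    (fun x _ => (testFun_differentiable hη x).hasDerivAt) ?_ ?_ ?_
  · exact testFun_integrable_mul hf.1.continuous.locallyIntegrable (testFun_deriv hη)
  · exact testFun_integrable_mul hd.1.continuous.locallyIntegrable hη
  · exact testFun_integrable_mul hf.1.continuous.locallyIntegrable hη

/-! ### The energy Hilbert space -/

/-- The measure `V_l(u) du` on `ℝ`, so that `L²(V_l du) = {ψ | V_l^{1/2} ψ ∈ L²(ℝ)}`. -/
def potentialMeasure (M : ℝ) (l : ℕ) : Measure ℝ :=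
  volume.withDensity fun u => ENNReal.ofReal (potential M l u)

theorem potentialMeasure_le {M : ℝ} (hM : 0 < M) (l : ℕ) :
    potentialMeasure M l ≤ ENNReal.ofReal (potentialBound M l) • volume := by
  rw [← withDensity_const]
  exact withDensity_mono (ae_of_all _ fun u => ENNReal.ofReal_le_ofReal (potential_le hM l u))

theorem volume_absolutelyContinuous {M : ℝ} (hM : 0 < M) (l : ℕ) :
    (volume : Measure ℝ) ≪ potentialMeasure M l :=
  withDensity_absolutelyContinuous' (measurable_potential hM l).ennreal_ofReal.aemeasurable
    (ae_of_all _ fun u => by simpa using potential_pos hM l u)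

theorem potentialMeasure_absolutelyContinuous (M : ℝ) (l : ℕ) :
    potentialMeasure M l ≪ (volume : Measure ℝ) :=
  withDensity_absolutelyContinuous _ _

theorem testFun_memLp_potential {M : ℝ} (hM : 0 < M) (l : ℕ) {f : ℝ → ℂ} (hf : f ∈ testFun) :
    MemLp f 2 (potentialMeasure M l) :=
  (testFun_memLp hf).of_measure_le_smul ENNReal.ofReal_ne_top (potentialMeasure_le hM l)

/-- The Hilbert space `H¹_{V_l}(ℝ) = {ψ | ψ' ∈ L²(ℝ), V_l^{1/2} ψ ∈ L²(ℝ)}` with scalar product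
`⟨ψ, φ⟩₁ = (ψ', φ')_{L²} + (V_l ψ, φ)_{L²}`.  An element is the pair `(ψ, ψ')` of a function
`ψ ∈ L²(V_l du)` and its weak derivative `ψ' ∈ L²(ℝ)`, which `ψ` determines; the scalar product is
the one of `L²(V_l du) ⊕ L²(ℝ)`. -/
def H1V {M : ℝ} (hM : 0 < M) (l : ℕ) :
    Submodule ℂ (WithLp 2 (Lp ℂ 2 (potentialMeasure M l) × Lp ℂ 2 (volume : Measure ℝ))) where
  carrier := {x | HasWeakDeriv x.fst x.snd}
  add_mem' {x y} hx hy :=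
    (HasWeakDeriv.add hx hy).congr
      ((volume_absolutelyContinuous hM l).ae_le (Lp.coeFn_add x.fst y.fst))
      (Lp.coeFn_add x.snd y.snd)
  zero_mem' :=
    HasWeakDeriv.zero.congr ((volume_absolutelyContinuous hM l).ae_le (Lp.coeFn_zero _ _ _))
      (Lp.coeFn_zero _ _ _)
  smul_mem' c x hx :=
    (HasWeakDeriv.smul c hx).congr
      ((volume_absolutelyContinuous hM l).ae_le (Lp.coeFn_smul c x.fst))
      (Lp.coeFn_smul c x.snd)

instance {M : ℝ} (hM : 0 < M) (l : ℕ) : NormedAddCommGroup (H1V hM l) :=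
  Submodule.normedAddCommGroup _

instance {M : ℝ} (hM : 0 < M) (l : ℕ) : InnerProductSpace ℂ (H1V hM l) :=
  Submodule.innerProductSpace _

/-- The inclusion `C_0^∞(ℝ) → H¹_{V_l}(ℝ)`, `f ↦ (f, f')`. -/
def testToH1V {M : ℝ} (hM : 0 < M) (l : ℕ) : testFun →ₗ[ℂ] H1V hM l where
  toFun f := ⟨WithLp.toLp 2 ((testFun_memLp_potential hM l f.2).toLp f.1,
      (testFun_memLp (testFun_deriv f.2)).toLp (deriv f.1)),
    (testFun_hasWeakDeriv f.2).congr
      ((volume_absolutelyContinuous hM l).ae_le (testFun_memLp_potential hM l f.2).coeFn_toLp)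
      (testFun_memLp (testFun_deriv f.2)).coeFn_toLp⟩
  map_add' f g := by
    have h : deriv (f.1 + g.1) = deriv f.1 + deriv g.1 := by
      ext u
      exact deriv_add (testFun_differentiable f.2 u) (testFun_differentiable g.2 u)
    apply Subtype.ext
    simp only [Submodule.coe_add, h]
    rfl
  map_smul' c f := by
    have h : deriv (c • f.1) = c • deriv f.1 := by
      ext u
      exact deriv_const_smul c (testFun_differentiable f.2 u)
    apply Subtype.ext
    simp only [Submodule.coe_smul, h]
    rfl

/-- `H¹_{V_l 0}(ℝ)`: the completion of `C_0^∞(ℝ)` within `H¹_{V_l}(ℝ)`. -/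
def H1V0 {M : ℝ} (hM : 0 < M) (l : ℕ) : Submodule ℂ (H1V hM l) :=
  (LinearMap.range (testToH1V hM l)).topologicalClosure

instance {M : ℝ} (hM : 0 < M) (l : ℕ) : NormedAddCommGroup (H1V0 hM l) :=
  Submodule.normedAddCommGroup _

instance {M : ℝ} (hM : 0 < M) (l : ℕ) : InnerProductSpace ℂ (H1V0 hM l) :=
  Submodule.innerProductSpace _

/-- The inclusion `C_0^∞(ℝ) → H¹_{V_l 0}(ℝ)`. -/
def testToH1V0 {M : ℝ} (hM : 0 < M) (l : ℕ) : testFun →ₗ[ℂ] H1V0 hM l :=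
  (testToH1V hM l).codRestrict (H1V0 hM l) fun f =>
    Submodule.le_topologicalClosure _ (LinearMap.mem_range_self _ f)

/-- The energy Hilbert space `H¹_{V_l 0}(ℝ) ⊕ L²(ℝ)`, whose scalar product is the energy scalar
product `∫ (conj ψ₂ φ₂ + conj ψ₁' φ₁' + V_l conj ψ₁ φ₁) du`. -/
abbrev EnergySpace {M : ℝ} (hM : 0 < M) (l : ℕ) : Type :=
  WithLp 2 (H1V0 hM l × Lp ℂ 2 (volume : Measure ℝ))

instance {M : ℝ} (hM : 0 < M) (l : ℕ) : NormedAddCommGroup (EnergySpace hM l) :=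
  WithLp.instProdNormedAddCommGroup 2 _ _

instance {M : ℝ} (hM : 0 < M) (l : ℕ) : InnerProductSpace ℂ (EnergySpace hM l) :=
  WithLp.instProdInnerProductSpace

/-- The function `u ↦ (ψ₁(u), ψ₂(u))` (defined up to null sets) of a vector of the energy space. -/
def EnergySpace.eval {M : ℝ} {hM : 0 < M} {l : ℕ} (Ψ : EnergySpace hM l) (u : ℝ) : Fin 2 → ℂ :=
  ![Ψ.fst.1.1.fst u, Ψ.snd u]

/-! ### The Hamiltonian -/

/-- The inclusion `C_0^∞(ℝ) → L²(ℝ)`. -/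
def testToL2 : testFun →ₗ[ℂ] Lp ℂ 2 (volume : Measure ℝ) where
  toFun f := (testFun_memLp f.2).toLp f.1
  map_add' _ _ := rfl
  map_smul' _ _ := rfl

theorem schrodinger_memLp {M : ℝ} (hM : 0 < M) (l : ℕ) {f : ℝ → ℂ} (hf : f ∈ testFun) :
    MemLp (fun u => -deriv (deriv f) u + (potential M l u : ℂ) * f u) 2
      (volume : Measure ℝ) := by
  refine (testFun_memLp (testFun_deriv (testFun_deriv hf))).neg.add ?_
  refine (testFun_memLp hf).of_le_mul (c := potentialBound M l) ?_ (ae_of_all _ fun u => ?_)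
  · exact ((Complex.measurable_ofReal.comp (measurable_potential hM l)).mul
      hf.1.continuous.measurable).aestronglyMeasurable
  · rw [norm_mul, Complex.norm_real, Real.norm_of_nonneg (potential_pos hM l u).le]
    gcongr
    exact potential_le hM l u

/-- The operator `f ↦ -f'' + V_l f` from `C_0^∞(ℝ)` to `L²(ℝ)`. -/
def schrodinger {M : ℝ} (hM : 0 < M) (l : ℕ) : testFun →ₗ[ℂ] Lp ℂ 2 (volume : Measure ℝ) where
  toFun f := (schrodinger_memLp hM l f.2).toLp _
  map_add' f g := by
    rw [← MemLp.toLp_add]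
    congr 1
    ext u
    have h : deriv (f.1 + g.1) = deriv f.1 + deriv g.1 := by
      ext u
      exact deriv_add (testFun_differentiable f.2 u) (testFun_differentiable g.2 u)
    have h2 : deriv (deriv f.1 + deriv g.1) u = deriv (deriv f.1) u + deriv (deriv g.1) u :=
      deriv_add (testFun_differentiable (testFun_deriv f.2) u)
        (testFun_differentiable (testFun_deriv g.2) u)
    simp only [Submodule.coe_add, h, h2, Pi.add_apply]
    ring
  map_smul' c f := by
    rw [RingHom.id_apply, ← MemLp.toLp_const_smul]
    congr 1
    ext u
    have h : deriv (c • f.1) = c • deriv f.1 := by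
      ext u
      exact deriv_const_smul c (testFun_differentiable f.2 u)
    have h2 : deriv (c • deriv f.1) u = c • deriv (deriv f.1) u :=
      deriv_const_smul c (testFun_differentiable (testFun_deriv f.2) u)
    simp only [Submodule.coe_smul, h, h2, Pi.smul_apply, smul_eq_mul]
    ring

/-- The inclusion `C_0^∞(ℝ)² → EnergySpace`. -/
def testToEnergy {M : ℝ} (hM : 0 < M) (l : ℕ) : testFun × testFun →ₗ[ℂ] EnergySpace hM l where
  toFun p := WithLp.toLp 2 (testToH1V0 hM l p.1, testToL2 p.2)
  map_add' p q := by simp [← WithLp.toLp_add]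
  map_smul' c p := by simp [← WithLp.toLp_smul]

theorem testToEnergy_injective {M : ℝ} (hM : 0 < M) (l : ℕ) :
    Function.Injective (testToEnergy hM l) := by
  rintro ⟨f, g⟩ ⟨f₁, g₁⟩ h
  have h1 : (testFun_memLp_potential hM l f.2).toLp f.1 =
      (testFun_memLp_potential hM l f₁.2).toLp f₁.1 :=
    congrArg (fun x : EnergySpace hM l => x.fst.1.1.fst) h
  have h2 : (testFun_memLp g.2).toLp g.1 = (testFun_memLp g₁.2).toLp g₁.1 :=
    congrArg (fun x : EnergySpace hM l => x.snd) h
  rw [MemLp.toLp_eq_toLp_iff] at h1 h2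
  have h1' := (volume_absolutelyContinuous hM l).ae_le h1
  have e1 := (f.2.1.continuous.ae_eq_iff_eq volume f₁.2.1.continuous).mp h1'
  have e2 := (g.2.1.continuous.ae_eq_iff_eq volume g₁.2.1.continuous).mp h2
  exact Prod.ext (Subtype.ext e1) (Subtype.ext e2)

/-- The action of the Hamiltonian on `C_0^∞(ℝ)²`, `(ψ₁, ψ₂) ↦ (ψ₂, -ψ₁'' + V_l ψ₁)`. -/
def hamiltonianAction {M : ℝ} (hM : 0 < M) (l : ℕ) :
    testFun × testFun →ₗ[ℂ] EnergySpace hM l where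
  toFun p := WithLp.toLp 2 (testToH1V0 hM l p.2, schrodinger hM l p.1)
  map_add' p q := by simp [← WithLp.toLp_add]
  map_smul' c p := by simp [← WithLp.toLp_smul]

/-- The Hamiltonian as an unbounded operator in the energy space with domain `C_0^∞(ℝ)²`. -/
def hamiltonianMin {M : ℝ} (hM : 0 < M) (l : ℕ) : EnergySpace hM l →ₗ.[ℂ] EnergySpace hM l where
  domain := LinearMap.range (testToEnergy hM l)
  toFun := hamiltonianAction hM l ∘ₗ
    (LinearEquiv.ofInjective (testToEnergy hM l) (testToEnergy_injective hM l)).symm.toLinearMap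

/-- The Hamiltonian `H`: the closure of its restriction to `C_0^∞(ℝ)²`. -/
def hamiltonian {M : ℝ} (hM : 0 < M) (l : ℕ) : EnergySpace hM l →ₗ.[ℂ] EnergySpace hM l :=
  (hamiltonianMin hM l).closure

/-- The bounded operator `R`, defined on the whole space, is the inverse `(T - ω)⁻¹` of the
bijection `T - ω : D(T) → E`. -/
def IsResolventAt {E : Type*} [NormedAddCommGroup E] [NormedSpace ℂ E] (T : E →ₗ.[ℂ] E) (ω : ℂ)
    (R : E →L[ℂ] E) : Prop :=
  (∀ x : T.domain, R (T x - ω • (x : E)) = x) ∧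
    ∀ y : E, ∃ h : R y ∈ T.domain, T ⟨R y, h⟩ - ω • R y = y

/-! ### Jost solutions and the Green's function -/

/-- `φ` is a (classical) solution of `-φ'' + V_ω φ = 0` on `ℝ`, where `V_ω = -ω² + V_l`. -/
def IsSchrodingerSolution (M : ℝ) (l : ℕ) (ω : ℂ) (φ : ℝ → ℂ) : Prop :=
  ContDiff ℝ 2 φ ∧
    ∀ u : ℝ, -deriv (deriv φ) u + (-ω ^ 2 + (potential M l u : ℂ)) * φ u = 0

/-- The exponent `iω` for `Im ω > 0` and `-iω` for `Im ω < 0`; its real part is `-|Im ω|`. -/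
def jostExponent (ω : ℂ) : ℂ := if 0 < ω.im then Complex.I * ω else -(Complex.I * ω)

/-- The Jost solution at `-∞`: with `κ = ±iω` as above, `e^{κu} φ(u) → 1` and
`(e^{κu} φ(u))' → 0` as `u → -∞`. -/
def IsJostAtBot (M : ℝ) (l : ℕ) (ω : ℂ) (φ : ℝ → ℂ) : Prop :=
  IsSchrodingerSolution M l ω φ ∧
    Tendsto (fun u : ℝ => Complex.exp (jostExponent ω * u) * φ u) atBot (𝓝 1) ∧
    Tendsto (deriv fun u : ℝ => Complex.exp (jostExponent ω * u) * φ u) atBot (𝓝 0)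

/-- The Jost solution at `+∞`: with `κ = ±iω` as above, `e^{-κu} φ(u) → 1` and
`(e^{-κu} φ(u))' → 0` as `u → +∞`. -/
def IsJostAtTop (M : ℝ) (l : ℕ) (ω : ℂ) (φ : ℝ → ℂ) : Prop :=
  IsSchrodingerSolution M l ω φ ∧
    Tendsto (fun u : ℝ => Complex.exp (-jostExponent ω * u) * φ u) atTop (𝓝 1) ∧
    Tendsto (deriv fun u : ℝ => Complex.exp (-jostExponent ω * u) * φ u) atTop (𝓝 0)

/-- The Wronskian `φ χ' - φ' χ`. -/
def wronskian (φ χ : ℝ → ℂ) (u : ℝ) : ℂ := φ u * deriv χ u - deriv φ u * χ u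

/-- The function `s(u, v) = -φ(u) χ(v) / w` for `u ≤ v` and `-φ(v) χ(u) / w` for `u > v`. -/
def greenFunction (φ χ : ℝ → ℂ) (w : ℂ) (u v : ℝ) : ℂ :=
  -(1 / w) * if u ≤ v then φ u * χ v else φ v * χ u

/-- `R` is the integral operator on the energy space with kernel `δ(u - v) A + K(u, v)`: for every
vector `Ψ`, the integral `∫ K(u, v) Ψ(v) dv` converges absolutely for every `u`, and
`(R Ψ)(u) = A Ψ(u) + ∫ K(u, v) Ψ(v) dv` for almost every `u`. -/
def IsIntegralOperatorWithKernel {M : ℝ} {hM : 0 < M} {l : ℕ}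
    (R : EnergySpace hM l →L[ℂ] EnergySpace hM l)
    (A : Matrix (Fin 2) (Fin 2) ℂ) (K : ℝ → ℝ → Matrix (Fin 2) (Fin 2) ℂ) : Prop :=
  ∀ Ψ : EnergySpace hM l,
    (∀ u : ℝ, Integrable fun v : ℝ => K u v *ᵥ Ψ.eval v) ∧
      ∀ᵐ u : ℝ, (R Ψ).eval u = A *ᵥ Ψ.eval u + ∫ v : ℝ, K u v *ᵥ Ψ.eval v

end Schwarzschild

end

namespace Schwarzschild

/-! ### Regularity and integrability of the potential -/

/-! The potential is smooth, positive, bounded and integrable in `u`; the last because `dr/du = 1 -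
2M/r` gives it an explicit bounded primitive. Integrability turns the equation for the amplitude
`e^{κu} φ` into a Volterra equation, solved by a contraction in a weighted sup norm
(`exists_volterra`, `exists_jost_amplitude`). Jost solutions at `+∞` are reflections of those at
`-∞`. If the Wronskian vanished, one nonzero solution would decay at both ends, which an energy
identity forbids for non-real `ω` (`IsODESolution.eq_zero_of_tendsto`).

Integration by parts makes the Hamiltonian symmetric on test functions, so `|Im ω| ‖x‖ ≤ ‖(H - ω)
x‖`. In a complete space this inequality and density of the range of `H - ω` on test functions give
the bounded inverse of the closure (`exists_isResolventAt_closure`). For density, the first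
component of `(H - ω)(f, g) = (p, q)` is solved exactly by `g = p + ωf`. What remains is `-f'' + (V
- ω²) f = q + ωp`; its solution by the Green's function decays exponentially, and slowly varying
cutoffs of it are test functions that solve the equation up to a small `L²` error
(`exists_testFun_approx`).

The matrix in the kernel is the column `(1, ω)` times the row `(ω, 1)`, so only the scalar integral
of `s (ωψ₁ + ψ₂)` matters. On `(H - ω)(f, g)` it returns `f`, by Green's identity. It extends by
density because for each `u` it is continuous in the energy norm: energy functions need not lie in
`L²`, but they grow at most linearly (`exists_energySpace_bound`) while the kernel decays
exponentially. -/

theorem hasDerivAt_reggeWheeler {M r : ℝ} (hM : 0 < M) (hr : 2 * M < r) :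
    HasDerivAt (reggeWheeler M) (1 - 2 * M / r)⁻¹ r := by
  have h1 : 0 < r / (2 * M) - 1 := by
    rw [sub_pos, lt_div_iff₀ (by positivity)]; linarith
  have h2 : HasDerivAt (fun r : ℝ => r / (2 * M) - 1) (1 / (2 * M)) r :=
    ((hasDerivAt_id r).div_const _).sub_const _
  have h3 := (hasDerivAt_id r).add ((h2.log h1.ne').const_mul (2 * M))
  refine h3.congr_deriv ?_
  have hr0 : r ≠ 0 := by linarith
  have h4 : r - 2 * M ≠ 0 := by linarith
  have h5 : r / (2 * M) - 1 = (r - 2 * M) / (2 * M) := by field_simp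
  have h6 : 1 - 2 * M / r = (r - 2 * M) / r := by field_simp
  rw [h5, h6]
  field_simp
  ring

theorem radius_reggeWheeler {M r : ℝ} (hM : 0 < M) (hr : 2 * M < r) :
    radius M (reggeWheeler M r) = r :=
  (reggeWheeler_strictMonoOn hM).injOn (radius_gt hM _) hr (reggeWheeler_radius hM _)

/-- A monotone function can only jump, and these values fill all of `(2M, ∞)`, which leaves no room
for a jump. -/
theorem continuous_radius {M : ℝ} (hM : 0 < M) : Continuous (radius M) := by
  refine continuous_iff_continuousAt.mpr fun u =>
    continuousAt_of_monotoneOn_of_image_mem_nhds (s := univ)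
      ((radius_monotone hM).monotoneOn _) univ_mem ?_
  refine mem_of_superset (Ioi_mem_nhds (radius_gt hM u)) fun r hr => ?_
  exact ⟨reggeWheeler M r, mem_univ _, radius_reggeWheeler hM hr⟩

theorem hasDerivAt_radius {M : ℝ} (hM : 0 < M) (u : ℝ) :
    HasDerivAt (radius M) (1 - 2 * M / radius M u) u := by
  have hr := radius_gt hM u
  have hr0 : 0 < radius M u := by linarith
  have h1 : 0 < 1 - 2 * M / radius M u := by
    rw [sub_pos, div_lt_one hr0]; exact hr
  have := HasDerivAt.of_local_left_inverse (continuous_radius hM).continuousAt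
    (hasDerivAt_reggeWheeler hM hr) (inv_ne_zero h1.ne')
    (Eventually.of_forall (reggeWheeler_radius hM))
  simpa using this

theorem radius_ne_zero {M : ℝ} (hM : 0 < M) (u : ℝ) : radius M u ≠ 0 := by
  have := radius_gt hM u
  linarith

/-- Bootstrapping: each use of `r' = 1 - 2M/r` gains one derivative. -/
theorem contDiff_radius {M : ℝ} (hM : 0 < M) : ContDiff ℝ (⊤ : ℕ∞) (radius M) := by
  have hd : deriv (radius M) = fun u => 1 - 2 * M / radius M u :=
    funext fun u => (hasDerivAt_radius hM u).deriv
  refine contDiff_infty.mpr fun n => ?_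
  induction n with
  | zero => exact contDiff_zero.mpr (continuous_radius hM)
  | succ n ih =>
    rw [Nat.cast_succ, contDiff_succ_iff_deriv]
    refine ⟨fun u => (hasDerivAt_radius hM u).differentiableAt, by simp, ?_⟩
    rw [hd]
    exact contDiff_const.sub (contDiff_const.div ih (radius_ne_zero hM))

theorem contDiff_potential {M : ℝ} (hM : 0 < M) (l : ℕ) :
    ContDiff ℝ (⊤ : ℕ∞) (potential M l) := by
  have h := contDiff_radius hM
  have h0 := radius_ne_zero hM
  unfold potential
  exact (contDiff_const.sub (contDiff_const.div h h0)).mul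
    ((contDiff_const.div (h.pow 3) fun u => pow_ne_zero _ (h0 u)).add
      (contDiff_const.div (h.pow 2) fun u => pow_ne_zero _ (h0 u)))

theorem continuous_potential {M : ℝ} (hM : 0 < M) (l : ℕ) : Continuous (potential M l) :=
  (contDiff_potential hM l).continuous

theorem integrable_potential {M : ℝ} (hM : 0 < M) (l : ℕ) : Integrable (potential M l) := by
  have hc := continuous_potential hM l
  -- A primitive of the potential: the factor `1 - 2M/r` is `dr/du`, so what is integrated is `2M/r³
  -- + l(l+1)/r²` in `r`. It is bounded because `r > 2M`.
  set N : ℝ → ℝ := fun u => -M * (radius M u ^ 2)⁻¹ - (l : ℝ) * ((l : ℝ) + 1) * (radius M u)⁻¹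
  have hN : ∀ u, HasDerivAt N (potential M l u) u := fun u => by
    have h := hasDerivAt_radius hM u
    have h0 := radius_ne_zero hM u
    have := (((h.pow 2).inv (pow_ne_zero 2 h0)).const_mul (-M)).sub
      ((h.inv h0).const_mul ((l : ℝ) * ((l : ℝ) + 1)))
    refine this.congr_deriv ?_
    unfold potential
    field_simp
    simp
    ring
  have hb : ∀ u, N u ≤ 0 ∧ -(M * ((2 * M) ^ 2)⁻¹ + (l : ℝ) * ((l : ℝ) + 1) * (2 * M)⁻¹) ≤ N u := by
    intro u
    have hr := radius_gt hM u
    have hr0 : 0 < radius M u := by linarith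
    have h1 : (radius M u ^ 2)⁻¹ ≤ ((2 * M) ^ 2)⁻¹ := by gcongr
    have h2 : (radius M u)⁻¹ ≤ (2 * M)⁻¹ := by gcongr
    have h3 : M * (radius M u ^ 2)⁻¹ ≤ M * ((2 * M) ^ 2)⁻¹ := by gcongr
    have h4 : (l : ℝ) * ((l : ℝ) + 1) * (radius M u)⁻¹ ≤ (l : ℝ) * ((l : ℝ) + 1) * (2 * M)⁻¹ := by
      gcongr
    have h5 : 0 ≤ M * (radius M u ^ 2)⁻¹ := by positivity
    have h6 : 0 ≤ (l : ℝ) * ((l : ℝ) + 1) * (radius M u)⁻¹ := by positivity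
    constructor <;> simp only [N] <;> linarith
  refine integrable_of_intervalIntegral_norm_bounded
    (M * ((2 * M) ^ 2)⁻¹ + (l : ℝ) * ((l : ℝ) + 1) * (2 * M)⁻¹)
    (fun n : ℕ => hc.integrableOn_Ioc) (tendsto_neg_atTop_atBot.comp tendsto_natCast_atTop_atTop)
    tendsto_natCast_atTop_atTop (Eventually.of_forall fun n => ?_)
  simp only [Real.norm_of_nonneg (potential_pos hM l _).le]
  rw [intervalIntegral.integral_eq_sub_of_hasDerivAt (fun u _ => hN u)
    (hc.intervalIntegrable _ _)]
  linarith [(hb n).1, (hb ((Neg.neg ∘ Nat.cast) n)).2]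

/-! ### Linear second order equations -/

/-- `f'' = q f`, with `f'` the derivative of `f`. -/
def IsODESolution (q f f' : ℝ → ℂ) : Prop :=
  ∀ u, HasDerivAt f (f' u) u ∧ HasDerivAt f' (q u * f u) u

/-- The same bootstrapping for `f'' = q f + h`. It makes the cutoffs in `exists_testFun_approx`
genuine test functions. -/
theorem contDiff_of_hasDerivAt {q h f f' : ℝ → ℂ} (hq : ContDiff ℝ (⊤ : ℕ∞) q)
    (hh : ContDiff ℝ (⊤ : ℕ∞) h) (hf : ∀ u, HasDerivAt f (f' u) u)
    (hf' : ∀ u, HasDerivAt f' (q u * f u + h u) u) : ContDiff ℝ (⊤ : ℕ∞) f := by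
  have e : deriv f = f' := funext fun u => (hf u).deriv
  have e' : deriv f' = fun u => q u * f u + h u := funext fun u => (hf' u).deriv
  have key : ∀ n : ℕ, ContDiff ℝ n f ∧ ContDiff ℝ n f' := by
    intro n
    induction n with
    | zero =>
      exact ⟨contDiff_zero.mpr (continuous_iff_continuousAt.mpr fun u => (hf u).continuousAt),
        contDiff_zero.mpr (continuous_iff_continuousAt.mpr fun u => (hf' u).continuousAt)⟩
    | succ n ih =>
      rw [Nat.cast_succ, contDiff_succ_iff_deriv, contDiff_succ_iff_deriv, e, e']
      exact ⟨⟨fun u => (hf u).differentiableAt, by simp, ih.2⟩,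
        fun u => (hf' u).differentiableAt, by simp,
        ((contDiff_infty.mp hq n).mul ih.1).add (contDiff_infty.mp hh n)⟩
  exact contDiff_infty.mpr fun n => (key n).1

/-- As a first order system for `(f, f')` in the max norm, the equation has Lipschitz constant `max
1 B` at all times, so uniqueness is global. -/
theorem IsODESolution.eq_zero {q f f' : ℝ → ℂ} {B : ℝ} (hq : ∀ u, ‖q u‖ ≤ B)
    (h : IsODESolution q f f') {u₀ : ℝ} (h0 : f u₀ = 0) (h0' : f' u₀ = 0) : f = 0 := by
  have hB : 0 ≤ B := (norm_nonneg _).trans (hq 0)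
  have hL : ∀ t, LipschitzOnWith (max 1 B.toNNReal)
      ((fun t (x : ℂ × ℂ) => (x.2, q t * x.1)) t) univ := fun t => by
    refine LipschitzWith.lipschitzOnWith (LipschitzWith.of_dist_le_mul fun x y => ?_)
    rw [Prod.dist_eq, Prod.dist_eq, NNReal.coe_max, Real.coe_toNNReal _ hB, NNReal.coe_one]
    refine max_le ?_ ?_
    · calc dist x.2 y.2 = 1 * dist x.2 y.2 := (one_mul _).symm
        _ ≤ _ := by
          gcongr
          · exact le_max_left _ _
          · exact le_max_right _ _
    · rw [dist_eq_norm, ← mul_sub, norm_mul, ← dist_eq_norm]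
      gcongr
      · exact (hq t).trans (le_max_right _ _)
      · exact le_max_left _ _
  have := ODE_solution_unique_univ (t₀ := u₀) (f := fun u => (f u, f' u)) (g := fun _ => 0) hL
    (fun t => ⟨(h t).1.prodMk (h t).2, mem_univ _⟩)
    (fun t => ⟨(hasDerivAt_const t (0 : ℂ × ℂ)).congr_deriv (by ext <;> simp), mem_univ _⟩)
    (by simp [h0, h0'])
  funext u
  exact congrArg Prod.fst (congrFun this u)

theorem IsODESolution.sub_smul {q f f' g g' : ℝ → ℂ} (hf : IsODESolution q f f')
    (hg : IsODESolution q g g') (c : ℂ) :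
    IsODESolution q (fun u => f u - c * g u) (fun u => f' u - c * g' u) := fun u =>
  ⟨(hf u).1.sub ((hg u).1.const_mul c),
    ((hf u).2.sub ((hg u).2.const_mul c)).congr_deriv (by ring)⟩

theorem IsODESolution.wronskian_hasDerivAt {q f f' g g' : ℝ → ℂ} (hf : IsODESolution q f f')
    (hg : IsODESolution q g g') (u : ℝ) :
    HasDerivAt (fun u => f u * g' u - f' u * g u) 0 u :=
  (((hf u).1.mul (hg u).2).sub ((hf u).2.mul (hg u).1)).congr_deriv (by ring)

theorem IsODESolution.wronskian_const {q f f' g g' : ℝ → ℂ} (hf : IsODESolution q f f')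
    (hg : IsODESolution q g g') (u v : ℝ) :
    f u * g' u - f' u * g u = f v * g' v - f' v * g v :=
  is_const_of_deriv_eq_zero
    (fun u => (hf.wronskian_hasDerivAt hg u).differentiableAt)
    (fun u => (hf.wronskian_hasDerivAt hg u).deriv) u v

/-- A vanishing Wronskian makes the Cauchy data at `u` proportional, and uniqueness spreads this to
the whole line. -/
theorem IsODESolution.exists_eq_mul {q f f' g g' : ℝ → ℂ} {B : ℝ} (hq : ∀ u, ‖q u‖ ≤ B)
    (hf : IsODESolution q f f') (hg : IsODESolution q g g') (hg0 : g ≠ 0) {u : ℝ}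
    (hw : f u * g' u - f' u * g u = 0) : ∃ c : ℂ, f = fun u => c * g u := by
  suffices h : ∃ c, f u - c * g u = 0 ∧ f' u - c * g' u = 0 by
    obtain ⟨c, h1, h2⟩ := h
    refine ⟨c, funext fun v => ?_⟩
    exact sub_eq_zero.mp (congrFun ((hf.sub_smul hg c).eq_zero hq h1 h2) v)
  by_cases h1 : g u = 0
  · have h2 : g' u ≠ 0 := fun h2 => hg0 (hg.eq_zero hq h1 h2)
    refine ⟨f' u / g' u, ?_, ?_⟩
    · rw [h1, mul_zero, sub_zero] at hw
      rw [h1, mul_zero, sub_zero]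
      exact (mul_eq_zero.mp hw).resolve_right h2
    · field_simp; ring
  · refine ⟨f u / g u, ?_, ?_⟩
    · field_simp; ring
    · field_simp
      linear_combination -hw

/-! ### Volterra equations and Jost solutions -/

/-- The integrand is the derivative of the right side, and the boundary term dropped at the lower
end is positive. The gain `1 / C` is what makes the Volterra operator a contraction. -/
theorem integral_Iic_mul_exp_le {V : ℝ → ℝ} (hc : Continuous V) (hi : Integrable V) {C I : ℝ}
    (hC : 0 < C) (hI : ∀ u, |∫ v in (0 : ℝ)..u, V v| ≤ I) (u : ℝ) :
    ∫ v in Iic u, V v * Real.exp (C * ∫ t in (0 : ℝ)..v, V t) ≤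
      Real.exp (C * ∫ t in (0 : ℝ)..u, V t) / C := by
  have hN : ∀ u, HasDerivAt (fun u => ∫ t in (0 : ℝ)..u, V t) (V u) u := fun u =>
    (hc.integral_hasStrictDerivAt 0 u).hasDerivAt
  have hNc : Continuous fun u => ∫ t in (0 : ℝ)..u, V t :=
    continuous_iff_continuousAt.mpr fun u => (hN u).continuousAt
  have hcE : Continuous fun v => V v * Real.exp (C * ∫ t in (0 : ℝ)..v, V t) := by fun_prop
  have hint : Integrable fun v => V v * Real.exp (C * ∫ t in (0 : ℝ)..v, V t) := by
    refine hi.mul_bdd (c := Real.exp (C * I)) (by fun_prop) (ae_of_all _ fun v => ?_)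
    rw [Real.norm_of_nonneg (Real.exp_pos _).le]
    gcongr
    exact (le_abs_self _).trans (hI v)
  refine le_of_tendsto (intervalIntegral_tendsto_integral_Iic u hint.integrableOn tendsto_id)
    (Eventually.of_forall fun a => ?_)
  have hd : ∀ v ∈ uIcc a u, HasDerivAt (fun v => Real.exp (C * ∫ t in (0 : ℝ)..v, V t) / C)
      (V v * Real.exp (C * ∫ t in (0 : ℝ)..v, V t)) v := fun v _ => by
    refine (((hN v).const_mul C).exp.div_const C).congr_deriv ?_
    field_simp
  rw [id, intervalIntegral.integral_eq_sub_of_hasDerivAt hd (hcE.intervalIntegrable _ _)]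
  have : 0 < Real.exp (C * ∫ t in (0 : ℝ)..a, V t) / C := by positivity
  linarith

theorem integrable_convolution_bdd {V : ℝ → ℝ} (hi : Integrable V) {k f : ℝ → ℂ}
    (hk : Continuous k) {b B : ℝ} (hb : ∀ t, ‖k t‖ ≤ b) (hf : Continuous f) (hB : ∀ u, ‖f u‖ ≤ B)
    (u : ℝ) : Integrable fun v => k (u - v) * (V v * f v) :=
  (hi.ofReal.mul_bdd (c := B) hf.aestronglyMeasurable (ae_of_all _ hB)).bdd_mul (c := b)
    (by fun_prop) (ae_of_all _ fun _ => hb _)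

/-- With `f = E g` and `E(u) = exp (C ∫₀ᵘ V)`, the equation becomes a fixed point problem for
bounded continuous `g`, contracting by `b / C ≤ 1/2` whatever the size of `∫ V`. Integrability of
`V` bounds `E` and `1/E`, so `f` is bounded too. -/
theorem exists_volterra {V : ℝ → ℝ} (hc : Continuous V) (h0 : ∀ u, 0 ≤ V u) (hi : Integrable V)
    {k : ℝ → ℂ} (hk : Continuous k) {b : ℝ} (hb : ∀ t, ‖k t‖ ≤ b) (hk0 : ∀ t ≤ 0, k t = 0) :
    ∃ f : ℝ → ℂ, Continuous f ∧ (∃ B, ∀ u, ‖f u‖ ≤ B) ∧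
      ∀ u, f u = 1 + ∫ v, k (u - v) * (V v * f v) := by
  have hb0 : 0 ≤ b := (norm_nonneg _).trans (hb 0)
  -- The factor 2 yields the contraction constant `1/2`; the `+ 1` keeps `C` positive when `b = 0`.
  set C := 2 * (b + 1) with hCdef
  have hC : 0 < C := by positivity
  set I := ∫ v, |V v|
  have hI : ∀ u, |∫ v in (0 : ℝ)..u, V v| ≤ I := fun u =>
    (intervalIntegral.norm_integral_le_integral_norm_uIoc).trans
      (setIntegral_le_integral hi.norm (ae_of_all _ fun _ => norm_nonneg _))
  have hNc : Continuous fun u => ∫ t in (0 : ℝ)..u, V t :=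
    continuous_iff_continuousAt.mpr fun u =>
      (hc.integral_hasStrictDerivAt 0 u).hasDerivAt.continuousAt
  set E : ℝ → ℝ := fun u => Real.exp (C * ∫ t in (0 : ℝ)..u, V t)
  have hE0 : ∀ u, 0 < E u := fun u => Real.exp_pos _
  have hEc : Continuous E := by fun_prop
  have hE1 : ∀ u, E u ≤ Real.exp (C * I) := fun u => by
    simp only [E]; gcongr; exact (le_abs_self _).trans (hI u)
  have hE2 : ∀ u, (E u)⁻¹ ≤ Real.exp (C * I) := fun u => by
    simp only [E]
    rw [← Real.exp_neg]
    gcongr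
    have := (neg_le_abs _).trans (hI u)
    nlinarith
  have hbd : ∀ (g : BoundedContinuousFunction ℝ ℂ) v, ‖(E v : ℂ) * g v‖ ≤ E v * ‖g‖ := fun g v => by
    rw [norm_mul, Complex.norm_real, Real.norm_of_nonneg (hE0 v).le]
    gcongr
    exact g.norm_coe_le_norm v
  have hbd' : ∀ (g : BoundedContinuousFunction ℝ ℂ) v,
      ‖(E v : ℂ) * g v‖ ≤ Real.exp (C * I) * ‖g‖ := fun g v =>
    (hbd g v).trans (by gcongr; exact hE1 v)
  have hint : ∀ (g : BoundedContinuousFunction ℝ ℂ) u,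
      Integrable fun v => k (u - v) * (V v * (E v * g v)) := fun g u =>
    integrable_convolution_bdd hi hk hb (by fun_prop) (hbd' g) u
  have hkey : ∀ (g : BoundedContinuousFunction ℝ ℂ) u,
      ‖∫ v, k (u - v) * (V v * (E v * g v))‖ ≤ b * ‖g‖ * (E u / C) := fun g u => by
    have hzero : ∀ v ∉ Iic u, k (u - v) * (V v * (E v * g v)) = 0 := fun v hv => by
      rw [hk0 _ (by have : u < v := not_le.mp hv
                    linarith), zero_mul]
    rw [← setIntegral_eq_integral_of_forall_compl_eq_zero hzero]
    have hVE : Integrable fun v => V v * E v :=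
      hi.mul_bdd (c := Real.exp (C * I)) hEc.aestronglyMeasurable (ae_of_all _ fun v => by
        rw [Real.norm_of_nonneg (hE0 v).le]; exact hE1 v)
    calc _ ≤ ∫ v in Iic u, b * ‖g‖ * (V v * E v) := by
          refine norm_integral_le_of_norm_le (hVE.const_mul _).integrableOn (ae_of_all _ fun v => ?_)
          rw [norm_mul, norm_mul, Complex.norm_real, Real.norm_of_nonneg (h0 v)]
          calc _ ≤ b * (V v * (E v * ‖g‖)) := by
                gcongr
                exacts [mul_nonneg (h0 v) (norm_nonneg _), hb _, h0 v, hbd g v]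
            _ = _ := by ring
      _ ≤ _ := by
          rw [integral_const_mul]
          gcongr
          exact integral_Iic_mul_exp_le hc hi hC hI u
  have hTc : ∀ g : BoundedContinuousFunction ℝ ℂ, Continuous fun u =>
      ((E u)⁻¹ : ℂ) * (1 + ∫ v, k (u - v) * (V v * (E v * g v))) := fun g => by
    have h1 : Continuous fun u => ∫ v, k (u - v) * (V v * (E v * g v)) := by
      refine continuous_of_dominated (bound := fun v => b * (V v * (Real.exp (C * I) * ‖g‖)))
        (fun u => (hint g u).aestronglyMeasurable) (fun u => ae_of_all _ fun v => ?_)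
        ((hi.mul_const _).const_mul _) (ae_of_all _ fun v => by fun_prop)
      rw [norm_mul, norm_mul, Complex.norm_real, Real.norm_of_nonneg (h0 v)]
      gcongr
      exacts [mul_nonneg (h0 v) (norm_nonneg _), hb _, h0 v, hbd' g v]
    refine Continuous.mul (Continuous.inv₀ (by fun_prop) fun u => ?_) (continuous_const.add h1)
    exact_mod_cast (hE0 u).ne'
  have hTb : ∀ (g : BoundedContinuousFunction ℝ ℂ) u,
      ‖((E u)⁻¹ : ℂ) * (1 + ∫ v, k (u - v) * (V v * (E v * g v)))‖ ≤
        Real.exp (C * I) * (1 + b * ‖g‖ * (Real.exp (C * I) / C)) := fun g u => by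
    rw [norm_mul, norm_inv, Complex.norm_real, Real.norm_of_nonneg (hE0 u).le]
    gcongr
    · exact hE2 u
    · refine (norm_add_le _ _).trans ?_
      rw [norm_one]
      gcongr
      refine (hkey g u).trans ?_
      gcongr
      exact hE1 u
  let T : BoundedContinuousFunction ℝ ℂ → BoundedContinuousFunction ℝ ℂ := fun g =>
    BoundedContinuousFunction.ofNormedAddCommGroup _ (hTc g) _ (hTb g)
  have hT : ContractingWith (1 / 2) T := by
    refine ⟨by rw [← NNReal.coe_lt_coe]; norm_num, LipschitzWith.of_dist_le_mul fun g h => ?_⟩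
    rw [BoundedContinuousFunction.dist_le (by positivity)]
    intro u
    have e : T g u - T h u = ((E u)⁻¹ : ℂ) * ∫ v, k (u - v) * (V v * (E v * (g - h) v)) := by
      simp only [T, BoundedContinuousFunction.coe_ofNormedAddCommGroup]
      rw [← mul_sub, add_sub_add_left_eq_sub, ← integral_sub (hint g u) (hint h u)]
      congr 2
      ext v
      simp only [BoundedContinuousFunction.coe_sub, Pi.sub_apply]
      ring
    rw [dist_eq_norm, e, norm_mul, norm_inv, Complex.norm_real, Real.norm_of_nonneg (hE0 u).le,
      dist_eq_norm]
    calc _ ≤ (E u)⁻¹ * (b * ‖g - h‖ * (E u / C)) := by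
          gcongr
          exact hkey _ u
      _ = b / C * ‖g - h‖ := by
          have := (hE0 u).ne'
          field_simp
      _ ≤ _ := by
          gcongr
          rw [div_le_iff₀ hC, hCdef]
          push_cast
          linarith
  obtain ⟨g, hg, -⟩ := hT.exists_fixedPoint 0 (edist_ne_top _ _)
  refine ⟨fun u => E u * g u, by fun_prop, ⟨_, hbd' g⟩, fun u => ?_⟩
  have h1 : g u = ((E u)⁻¹ : ℂ) * (1 + ∫ v, k (u - v) * (V v * (E v * g v))) :=
    (congrArg (fun x : BoundedContinuousFunction ℝ ℂ => x u) hg).symm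
  have h2 : (E u : ℂ) ≠ 0 := by exact_mod_cast (hE0 u).ne'
  calc (E u : ℂ) * g u = E u * (((E u)⁻¹ : ℂ) * (1 + ∫ v, k (u - v) * (V v * (E v * g v)))) := by
        rw [← h1]
    _ = _ := by rw [← mul_assoc, mul_inv_cancel₀ h2, one_mul]

theorem hasDerivAt_integral_Iic {f : ℝ → ℂ} (hf : Continuous f)
    (hi : ∀ u, IntegrableOn f (Iic u)) (u : ℝ) :
    HasDerivAt (fun u => ∫ v in Iic u, f v) (f u) u := by
  have : (fun u => ∫ v in Iic u, f v) = fun u => (∫ v in Iic 0, f v) + ∫ v in (0 : ℝ)..u, f v := by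
    funext u
    rw [← intervalIntegral.integral_Iic_sub_Iic (hi 0) (hi u)]
    ring
  rw [this]
  exact (hf.integral_hasStrictDerivAt 0 u).hasDerivAt.const_add _

theorem norm_exp_mul_ofReal (κ : ℂ) (u : ℝ) : ‖Complex.exp (κ * u)‖ = Real.exp (κ.re * u) := by
  rw [Complex.norm_exp, Complex.re_mul_ofReal]

theorem hasDerivAt_exp_mul (κ : ℂ) (u : ℝ) :
    HasDerivAt (fun u : ℝ => Complex.exp (κ * u)) (κ * Complex.exp (κ * u)) u := by
  refine (((hasDerivAt_id u).ofReal_comp.const_mul κ).cexp).congr_deriv ?_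
  simp [mul_comm]

/-- The amplitude `f = e^{κu} φ` of a Jost solution at `-∞`. -/
theorem exists_jost_amplitude {V : ℝ → ℝ} (hc : Continuous V) (h0 : ∀ u, 0 ≤ V u)
    (hi : Integrable V) {κ : ℂ} (hκ : κ.re < 0) :
    ∃ f f' : ℝ → ℂ, (∀ u, HasDerivAt f (f' u) u) ∧
      (∀ u, HasDerivAt f' (2 * κ * f' u + V u * f u) u) ∧
      Tendsto f atBot (𝓝 1) ∧ Tendsto f' atBot (𝓝 0) := by
  have hκ0 : κ ≠ 0 := fun h => by simp [h] at hκ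
  -- Variation of constants for `f'' = 2κ f' + V f` with `f → 1` at `-∞`. The maximum makes `k`
  -- vanish for `t ≤ 0`, and `Re κ < 0` keeps it bounded.
  set k : ℝ → ℂ := fun t => (Complex.exp (2 * κ * (max t 0 : ℝ)) - 1) / (2 * κ)
  have hk : Continuous k := by fun_prop
  have hkb : ∀ t, ‖k t‖ ≤ 2 / ‖2 * κ‖ := fun t => by
    rw [norm_div]
    gcongr
    refine (norm_sub_le _ _).trans ?_
    rw [norm_exp_mul_ofReal, norm_one]
    have : Real.exp ((2 * κ).re * max t 0) ≤ 1 := by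
      rw [Real.exp_le_one_iff]
      have : (2 * κ).re = 2 * κ.re := by simp
      rw [this]
      nlinarith [le_max_right t 0]
    linarith
  have hk0 : ∀ t ≤ 0, k t = 0 := fun t ht => by simp [k, max_eq_right ht]
  obtain ⟨f, hf, ⟨B, hB⟩, hfe⟩ := exists_volterra hc h0 hi hk hkb hk0
  have hcV : Continuous fun v => (V v : ℂ) * f v := by fun_prop
  have hcV' : Continuous fun v : ℝ => Complex.exp (-(2 * κ) * v) * ((V v : ℂ) * f v) := by fun_prop
  have hVf : Integrable fun v => (V v : ℂ) * f v :=
    hi.ofReal.mul_bdd (c := B) hf.aestronglyMeasurable (ae_of_all _ hB)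
  have hre : (-(2 * κ)).re = -(2 * κ.re) := by simp
  have hint : ∀ u, IntegrableOn (fun v : ℝ => Complex.exp (-(2 * κ) * v) * ((V v : ℂ) * f v))
      (Iic u) := fun u => by
    refine hVf.integrableOn.bdd_mul (c := Real.exp (-(2 * κ.re) * u)) (by fun_prop) ?_
    filter_upwards [ae_restrict_mem measurableSet_Iic] with v hv
    rw [norm_exp_mul_ofReal, hre]
    gcongr
    · linarith
    · exact hv
  set A : ℝ → ℂ := fun u => ∫ v in Iic u, Complex.exp (-(2 * κ) * v) * ((V v : ℂ) * f v)
  set D : ℝ → ℂ := fun u => ∫ v in Iic u, (V v : ℂ) * f v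
  have hA : ∀ u, HasDerivAt A _ u := hasDerivAt_integral_Iic hcV' hint
  have hD : ∀ u, HasDerivAt D _ u := hasDerivAt_integral_Iic hcV fun u => hVf.integrableOn
  -- Splitting the kernel separates `u` from `v`. On differentiation the two terms `V f` cancel,
  -- leaving `f' = e^{2κu} A`.
  have hfe' : f = fun u : ℝ => 1 + (Complex.exp (2 * κ * u) * A u - D u) / (2 * κ) := by
    funext u
    have hzero : ∀ v ∉ Iic u, k (u - v) * (V v * f v) = 0 := fun v hv => by
      rw [hk0 _ (by have : u < v := not_le.mp hv
                    linarith), zero_mul]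
    rw [hfe u, ← setIntegral_eq_integral_of_forall_compl_eq_zero hzero,
      ← integral_const_mul, ← integral_sub ((hint u).const_mul _) hVf.integrableOn,
      ← integral_div]
    congr 1
    refine setIntegral_congr_fun measurableSet_Iic fun v hv => ?_
    have : max (u - v) 0 = u - v := max_eq_left (sub_nonneg.mpr hv)
    have e : Complex.exp (2 * κ * ((u - v : ℝ) : ℂ)) =
        Complex.exp (2 * κ * u) * Complex.exp (-(2 * κ) * v) := by
      rw [← Complex.exp_add]; congr 1; push_cast; ring
    simp only [k, this, e]
    ring
  have hex := hasDerivAt_exp_mul (2 * κ)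
  have hinv : ∀ u : ℝ, Complex.exp (2 * κ * u) * Complex.exp (-(2 * κ) * u) = 1 := fun u => by
    rw [← Complex.exp_add, neg_mul, add_neg_cancel, Complex.exp_zero]
  -- The growth of `e^{2κu}` at `-∞` is compensated under the integral, since `|e^{2κ(u - v)}| ≤ 1`
  -- for `v ≤ u`.
  have hbound : ∀ u : ℝ, ‖Complex.exp (2 * κ * u) * A u‖ ≤ B * ∫ v in Iic u, V v := fun u => by
    rw [← integral_const_mul, ← integral_const_mul]
    refine norm_integral_le_of_norm_le (hi.const_mul _).integrableOn ?_
    filter_upwards [ae_restrict_mem measurableSet_Iic] with v hv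
    rw [norm_mul, norm_mul, norm_mul, norm_exp_mul_ofReal, norm_exp_mul_ofReal, Complex.norm_real,
      Real.norm_of_nonneg (h0 v), ← mul_assoc, ← Real.exp_add]
    calc _ ≤ 1 * (V v * B) := by
          gcongr
          · exact mul_nonneg (h0 v) (norm_nonneg _)
          · rw [Real.exp_le_one_iff, hre]
            have : (2 * κ).re = 2 * κ.re := by simp
            rw [this]
            have : v ≤ u := hv
            nlinarith
          · exact h0 v
          · exact hB v
      _ = _ := by ring
  have hDb : ∀ u : ℝ, ‖D u‖ ≤ B * ∫ v in Iic u, V v := fun u => by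
    rw [← integral_const_mul]
    refine norm_integral_le_of_norm_le (hi.const_mul _).integrableOn (ae_of_all _ fun v => ?_)
    rw [norm_mul, Complex.norm_real, Real.norm_of_nonneg (h0 v), mul_comm B]
    gcongr
    exacts [h0 v, hB v]
  have hlim : Tendsto (fun u => B * ∫ v in Iic u, V v) atBot (𝓝 0) := by
    simpa using (tendsto_integral_Iic_zero (f := V) (μ := volume) tendsto_id).const_mul B
  have hf'0 : Tendsto (fun u : ℝ => Complex.exp (2 * κ * u) * A u) atBot (𝓝 0) :=
    squeeze_zero_norm hbound hlim
  refine ⟨f, fun u => Complex.exp (2 * κ * u) * A u, fun u => ?_, fun u => ?_, ?_, hf'0⟩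
  · nth_rw 1 [hfe']
    refine (((((hex u).mul (hA u)).sub (hD u)).div_const _).const_add _).congr_deriv ?_
    rw [← mul_assoc (Complex.exp (2 * κ * u)), hinv]
    field_simp
    ring
  · refine ((hex u).mul (hA u)).congr_deriv ?_
    rw [← mul_assoc (Complex.exp (2 * κ * u)), hinv]
    ring
  · rw [hfe']
    have := ((hf'0.sub (squeeze_zero_norm hDb hlim)).div_const (2 * κ)).const_add 1
    simpa using this

/-- Jost solutions at `-∞` of `φ'' = (V + κ²) φ`. -/
structure IsJost (V : ℝ → ℝ) (κ : ℂ) (φ φ' : ℝ → ℂ) : Prop where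
  sol : IsODESolution (fun u => V u + κ ^ 2) φ φ'
  lim : Tendsto (fun u : ℝ => Complex.exp (κ * u) * φ u) atBot (𝓝 1)
  lim' : Tendsto (fun u : ℝ => Complex.exp (κ * u) * φ' u) atBot (𝓝 (-κ))

theorem exists_isJost {V : ℝ → ℝ} (hc : Continuous V) (h0 : ∀ u, 0 ≤ V u)
    (hi : Integrable V) {κ : ℂ} (hκ : κ.re < 0) : ∃ φ φ', IsJost V κ φ φ' := by
  obtain ⟨f, f', hf, hf', hl, hl'⟩ := exists_jost_amplitude hc h0 hi hκ
  have hinv : ∀ u : ℝ, Complex.exp (κ * u) * Complex.exp (-κ * u) = 1 := fun u => by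
    rw [← Complex.exp_add, neg_mul, add_neg_cancel, Complex.exp_zero]
  refine ⟨fun u => Complex.exp (-κ * u) * f u, fun u => Complex.exp (-κ * u) * (f' u - κ * f u),
    fun u => ⟨?_, ?_⟩, ?_, ?_⟩
  · exact ((hasDerivAt_exp_mul (-κ) u).mul (hf u)).congr_deriv (by ring)
  · refine ((hasDerivAt_exp_mul (-κ) u).mul ((hf' u).sub ((hf u).const_mul κ))).congr_deriv ?_
    simp only [Pi.sub_apply]
    ring
  · simpa only [← mul_assoc, hinv, one_mul] using hl
  · simpa only [← mul_assoc, hinv, one_mul, mul_one, zero_sub] using hl'.sub (hl.const_mul κ)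

theorem eq_exp_neg_mul_exp_mul (κ : ℂ) (f : ℝ → ℂ) (u : ℝ) :
    f u = Complex.exp (-κ * u) * (Complex.exp (κ * u) * f u) := by
  rw [← mul_assoc, ← Complex.exp_add, neg_mul, neg_add_cancel, Complex.exp_zero, one_mul]

theorem isBigO_exp_of_tendsto {κ c : ℂ} {f : ℝ → ℂ}
    (h : Tendsto (fun u : ℝ => Complex.exp (κ * u) * f u) atBot (𝓝 c)) :
    f =O[atBot] fun u : ℝ => Real.exp (-κ.re * u) := by
  have h1 := h.isBigO_one ℝ
  have h2 : (fun u : ℝ => Complex.exp (-κ * u)) =O[atBot] fun u : ℝ => Real.exp (-κ.re * u) :=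
    Asymptotics.IsBigO.of_bound 1 (Eventually.of_forall fun u => by
      rw [norm_exp_mul_ofReal, Real.norm_of_nonneg (Real.exp_pos _).le, one_mul, Complex.neg_re])
  have h3 := h2.mul h1
  simp only [mul_one] at h3
  exact h3.congr_left fun u => (eq_exp_neg_mul_exp_mul κ f u).symm

theorem tendsto_exp_atBot_zero {a : ℝ} (ha : 0 < a) :
    Tendsto (fun u : ℝ => Real.exp (a * u)) atBot (𝓝 0) :=
  Real.tendsto_exp_atBot.comp (tendsto_id.const_mul_atBot ha)

/-! ### Decay and uniqueness of Jost solutions -/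

section

variable {V : ℝ → ℝ} {κ : ℂ} {φ φ' : ℝ → ℂ}

theorem IsJost.tendsto_zero (h : IsJost V κ φ φ') (hκ : κ.re < 0) : Tendsto φ atBot (𝓝 0) :=
  (isBigO_exp_of_tendsto h.lim).trans_tendsto (tendsto_exp_atBot_zero (by linarith))

theorem IsJost.tendsto_zero' (h : IsJost V κ φ φ') (hκ : κ.re < 0) : Tendsto φ' atBot (𝓝 0) :=
  (isBigO_exp_of_tendsto h.lim').trans_tendsto (tendsto_exp_atBot_zero (by linarith))

theorem IsJost.ne_zero (h : IsJost V κ φ φ') : φ ≠ 0 := fun h0 => by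
  have := h.lim
  simp only [h0, Pi.zero_apply, mul_zero] at this
  exact zero_ne_one (tendsto_nhds_unique tendsto_const_nhds this)

/-- Both solutions and their derivatives decay at `-∞`, so the constant Wronskian is zero. The
solutions are then proportional, with factor 1 by the normalisation. -/
theorem IsJost.unique (h : IsJost V κ φ φ') (hκ : κ.re < 0) {χ χ' : ℝ → ℂ}
    (h₁ : IsJost V κ χ χ') {B : ℝ} (hB : ∀ u, ‖(V u : ℂ) + κ ^ 2‖ ≤ B) : χ = φ := by
  have hw : χ 0 * φ' 0 - χ' 0 * φ 0 = 0 := by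
    have h1 : Tendsto (fun u => χ u * φ' u - χ' u * φ u) atBot (𝓝 0) := by
      simpa using ((h₁.tendsto_zero hκ).mul (h.tendsto_zero' hκ)).sub
        ((h₁.tendsto_zero' hκ).mul (h.tendsto_zero hκ))
    refine tendsto_nhds_unique (h1.congr fun u => ?_) tendsto_const_nhds |>.symm
    exact h₁.sol.wronskian_const h.sol u 0
  obtain ⟨c, hc⟩ := h₁.sol.exists_eq_mul hB h.sol h.ne_zero hw
  have h2 : Tendsto (fun u : ℝ => Complex.exp (κ * u) * χ u) atBot (𝓝 c) := by
    have := h.lim.const_mul c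
    rw [mul_one] at this
    refine this.congr fun u => ?_
    rw [hc]; ring
  have hc1 : c = 1 := tendsto_nhds_unique h2 h₁.lim
  rw [hc, hc1]
  simp

/-- A solution that decays with its derivative at both ends vanishes if `κ = ± i ω` with `ω` not
real. -/
theorem IsODESolution.eq_zero_of_tendsto {ω : ℂ} (hω : ω.im ≠ 0) (h0 : ∀ u, 0 ≤ V u)
    (h : IsODESolution (fun u => V u - ω ^ 2) φ φ')
    (hb : Tendsto φ atBot (𝓝 0)) (hb' : Tendsto φ' atBot (𝓝 0))
    (ht : Tendsto φ atTop (𝓝 0)) (ht' : Tendsto φ' atTop (𝓝 0)) : φ = 0 := by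
  -- The factor `conj ω` gives every term of `Im G'` the same sign: `Im (conj ω) = -Im ω` and `Im
  -- (-conj ω ω²) = -|ω|² Im ω`. Hence `-Im G / Im ω` has derivative `P ≥ 0`, also for purely
  -- imaginary `ω`.
  set G : ℝ → ℂ := fun u => star ω * (star (φ u) * φ' u)
  set P : ℝ → ℝ := fun u => ‖φ' u‖ ^ 2 + (V u + ‖ω‖ ^ 2) * ‖φ u‖ ^ 2
  have hP : ∀ u, 0 ≤ P u := fun u => by
    have := h0 u
    positivity
  have hG : ∀ u, HasDerivAt (fun u => -(G u).im / ω.im) (P u) u := fun u => by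
    have h1 : HasDerivAt G _ u := (((h u).1.star).mul (h u).2).const_mul (star ω)
    have h2 := ((Complex.imCLM.hasFDerivAt.comp_hasDerivAt u h1).neg).div_const ω.im
    refine h2.congr_deriv ?_
    rw [div_eq_iff hω]
    simp only [P, Complex.sq_norm, Complex.normSq_apply]
    simp only [Complex.imCLM_apply, Complex.star_def,
      Complex.mul_im, Complex.mul_re, Complex.conj_re, Complex.conj_im, Complex.add_im,
      Complex.add_re, Complex.sub_im, Complex.sub_re, Complex.ofReal_re, Complex.ofReal_im, pow_two]
    ring
  have hmono : Monotone fun u => -(G u).im / ω.im :=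
    monotone_of_hasDerivAt_nonneg hG fun u => hP u
  have hlim : ∀ {l : Filter ℝ}, Tendsto φ l (𝓝 0) → Tendsto φ' l (𝓝 0) →
      Tendsto (fun u => -(G u).im / ω.im) l (𝓝 0) := fun {l} h1 h2 => by
    have h3 : Tendsto G l (𝓝 0) := by
      have := (h1.star.mul h2).const_mul (star ω)
      rwa [mul_zero, mul_zero] at this
    have h4 := (((Complex.continuous_im.tendsto _).comp h3).neg).div_const ω.im
    simpa using h4
  -- A monotone function with limit 0 at both ends is zero, so its derivative `P` vanishes.
  have hz : (fun u => -(G u).im / ω.im) = fun _ => 0 := funext fun u =>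
    le_antisymm (hmono.ge_of_tendsto (hlim ht ht') u) (hmono.le_of_tendsto (hlim hb hb') u)
  funext u
  have hPu : P u = 0 := by
    have := hG u
    rw [hz] at this
    exact this.unique (hasDerivAt_const u 0)
  have hω0 : 0 < ‖ω‖ := norm_pos_iff.mpr fun h => hω (by simp [h])
  have h1 : 0 ≤ ‖φ' u‖ ^ 2 := by positivity
  have h2 : 0 ≤ V u * ‖φ u‖ ^ 2 := mul_nonneg (h0 u) (by positivity)
  have h3 : ‖ω‖ ^ 2 * ‖φ u‖ ^ 2 ≤ 0 := by
    simp only [P] at hPu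
    nlinarith
  by_contra h4
  have : 0 < ‖φ u‖ := norm_pos_iff.mpr h4
  have : 0 < ‖ω‖ ^ 2 * ‖φ u‖ ^ 2 := by positivity
  linarith

end

/-! ### Functions of exponential decay -/

theorem exists_exp_decay_bound {F : ℝ → ℂ} {a : ℝ} (hF : Continuous F)
    (hb : F =O[atBot] fun u => Real.exp (a * u)) (ht : F =O[atTop] fun u => Real.exp (-a * u)) :
    ∃ C, ∀ u, ‖F u‖ ≤ C * Real.exp (-a * |u|) := by
  have hc : Continuous fun u => F u * (Real.exp (a * |u|) : ℂ) := by fun_prop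
  have hone : ∀ {l : Filter ℝ} {g : ℝ → ℝ}, F =O[l] g →
      (∀ᶠ u in l, g u * Real.exp (a * |u|) = 1) →
      (fun u => F u * (Real.exp (a * |u|) : ℂ)) =O[l] (1 : ℝ → ℝ) := fun {l g} h1 h2 => by
    have h3 : (fun u => (Real.exp (a * |u|) : ℂ)) =O[l] fun u => Real.exp (a * |u|) :=
      Asymptotics.IsBigO.of_bound 1 (Eventually.of_forall fun u => by
        rw [Complex.norm_real, one_mul])
    exact (h1.mul h3).congr' EventuallyEq.rfl h2
  have hr := (hc.isBounded_range_iff_isBigO_atTop_atBot).mpr ⟨hone ht ?_, hone hb ?_⟩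
  · obtain ⟨C, hC⟩ := hr.exists_norm_le
    refine ⟨C, fun u => ?_⟩
    have h1 := hC _ (mem_range_self u)
    rw [norm_mul, Complex.norm_real, Real.norm_of_nonneg (Real.exp_pos _).le] at h1
    calc ‖F u‖ = ‖F u‖ * Real.exp (a * |u|) * Real.exp (-a * |u|) := by
          rw [mul_assoc, ← Real.exp_add]; simp
      _ ≤ _ := by gcongr
  · filter_upwards [eventually_ge_atTop 0] with u hu
    rw [abs_of_nonneg hu, ← Real.exp_add]; simp
  · filter_upwards [eventually_le_atBot 0] with u hu
    rw [abs_of_nonpos hu, ← Real.exp_add]; simp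

theorem integrable_exp_neg_mul_abs {a : ℝ} (ha : 0 < a) :
    Integrable fun u : ℝ => Real.exp (-a * |u|) := by
  rw [← integrableOn_univ, ← Iic_union_Ioi (a := (0 : ℝ)), integrableOn_union]
  constructor
  · refine (integrableOn_exp_mul_Iic ha 0).congr_fun (fun u hu => ?_) measurableSet_Iic
    simp only [abs_of_nonpos (show u ≤ 0 from hu)]
    ring_nf
  · refine (integrableOn_exp_mul_Ioi (neg_lt_zero.mpr ha) 0).congr_fun (fun u hu => ?_)
      measurableSet_Ioi
    simp only [abs_of_pos (show 0 < u from hu)]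

theorem memLp_exp_neg_mul_abs {a : ℝ} (ha : 0 < a) :
    MemLp (fun u : ℝ => Real.exp (-a * |u|)) 2 volume := by
  rw [memLp_two_iff_integrable_sq (by fun_prop)]
  refine (integrable_exp_neg_mul_abs (mul_pos two_pos ha)).congr (ae_of_all _ fun u => ?_)
  simp only [← Real.exp_nat_mul]
  push_cast
  ring_nf

/-- Half of the exponent absorbs the linear factor, which is the growth permitted by
`exists_energySpace_bound`. -/
theorem integrable_one_add_abs_mul_exp {a : ℝ} (ha : 0 < a) :
    Integrable fun u : ℝ => (1 + |u|) * Real.exp (-a * |u|) := by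
  refine ((integrable_exp_neg_mul_abs (half_pos ha)).const_mul (1 + 2 / a)).mono' (by fun_prop)
    (ae_of_all _ fun u => ?_)
  rw [Real.norm_of_nonneg (by positivity)]
  have h1 : a / 2 * |u| ≤ Real.exp (a / 2 * |u|) := by
    linarith [Real.add_one_le_exp (a / 2 * |u|)]
  have h2 : 1 ≤ Real.exp (a / 2 * |u|) := Real.one_le_exp (by positivity)
  have h3 : 1 + |u| ≤ (1 + 2 / a) * Real.exp (a / 2 * |u|) := by
    have : |u| = 2 / a * (a / 2 * |u|) := by field_simp
    calc 1 + |u| = 1 + 2 / a * (a / 2 * |u|) := by rw [← this]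
      _ ≤ Real.exp (a / 2 * |u|) + 2 / a * Real.exp (a / 2 * |u|) := by gcongr
      _ = _ := by ring
  calc _ ≤ (1 + 2 / a) * Real.exp (a / 2 * |u|) * Real.exp (-a * |u|) := by gcongr
    _ = _ := by
      rw [mul_assoc, ← Real.exp_add]
      ring_nf

/-! ### The Green's function -/

/-- A solution `φ` of `-φ'' + (V - ω²) φ = 0` decaying at `-∞` and a solution `χ` decaying at
`+∞`, with Wronskian `w ≠ 0`. -/
structure IsGreenPair (V : ℝ → ℝ) (ω : ℂ) (a : ℝ) (w : ℂ) (φ φ' χ χ' : ℝ → ℂ) : Prop where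
  pos : 0 < a
  sol_left : IsODESolution (fun u => V u - ω ^ 2) φ φ'
  sol_right : IsODESolution (fun u => V u - ω ^ 2) χ χ'
  left : φ =O[atBot] fun u => Real.exp (a * u)
  left' : φ' =O[atBot] fun u => Real.exp (a * u)
  right : χ =O[atTop] fun u => Real.exp (-a * u)
  right' : χ' =O[atTop] fun u => Real.exp (-a * u)
  wronskian : ∀ u, φ u * χ' u - φ' u * χ u = w
  ne_zero : w ≠ 0

theorem IsODESolution.continuous {q f f' : ℝ → ℂ} (h : IsODESolution q f f') : Continuous f :=
  continuous_iff_continuousAt.mpr fun u => (h u).1.continuousAt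

theorem IsODESolution.continuous' {q f f' : ℝ → ℂ} (h : IsODESolution q f f') : Continuous f' :=
  continuous_iff_continuousAt.mpr fun u => (h u).2.continuousAt

theorem testFun_eventually_atTop {h : ℝ → ℂ} (hh : h ∈ testFun) : ∀ᶠ u in atTop, h u = 0 := by
  obtain ⟨R, -, hR⟩ := hh.2.exists_pos_le_norm
  filter_upwards [eventually_ge_atTop R] with u hu
  exact hR u (hu.trans (le_abs_self u))

theorem testFun_eventually_atBot {h : ℝ → ℂ} (hh : h ∈ testFun) : ∀ᶠ u in atBot, h u = 0 := by
  obtain ⟨R, -, hR⟩ := hh.2.exists_pos_le_norm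
  filter_upwards [eventually_le_atBot (-R)] with u hu
  exact hR u ((le_neg_of_le_neg hu).trans (neg_le_abs u))

section

variable {V : ℝ → ℝ} {ω : ℂ} {a : ℝ} {w : ℂ} {φ φ' χ χ' : ℝ → ℂ}

theorem IsGreenPair.continuous_greenFunction (g : IsGreenPair V ω a w φ φ' χ χ') (u : ℝ) :
    Continuous (greenFunction φ χ w u) := by
  have h1 := g.sol_left.continuous
  have h2 := g.sol_right.continuous
  refine continuous_const.mul (Continuous.if_le ?_ ?_ continuous_const continuous_id ?_)
  · fun_prop
  · fun_prop
  · rintro v rfl; rfl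

theorem IsGreenPair.exists_greenFunction_bound (g : IsGreenPair V ω a w φ φ' χ χ') (u : ℝ) :
    ∃ C, ∀ v, ‖greenFunction φ χ w u v‖ ≤ C * Real.exp (-a * |v|) := by
  refine exists_exp_decay_bound (g.continuous_greenFunction u) ?_ ?_
  · refine (g.left.const_mul_left (-(1 / w) * χ u)).congr' ?_ EventuallyEq.rfl
    filter_upwards [eventually_lt_atBot u] with v hv
    rw [greenFunction, if_neg (not_le.mpr hv)]
    ring
  · refine (g.right.const_mul_left (-(1 / w) * φ u)).congr' ?_ EventuallyEq.rfl
    filter_upwards [eventually_ge_atTop u] with v hv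
    rw [greenFunction, if_pos hv]
    ring

/-- Lagrange's identity: for a solution `ψ`, the product of `ψ` and `-f'' + (V - ω²) f` is the
derivative of `ψ' f - ψ f'`. Compact support kills the boundary terms at infinity; those at `u`
combine to `f u` times the Wronskian. -/
theorem IsGreenPair.integral_greenFunction_mul (g : IsGreenPair V ω a w φ φ' χ χ')
    (hV : Continuous V) {f : ℝ → ℂ} (hf : f ∈ testFun) (u : ℝ) :
    ∫ v, greenFunction φ χ w u v * (-deriv (deriv f) v + (V v - ω ^ 2) * f v) = f u := by
  have hf' := testFun_deriv hf
  have hf'' := testFun_deriv hf'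
  have hd : ∀ v, HasDerivAt f (deriv f v) v := fun v => (testFun_differentiable hf v).hasDerivAt
  have hd' : ∀ v, HasDerivAt (deriv f) (deriv (deriv f) v) v := fun v =>
    (testFun_differentiable hf' v).hasDerivAt
  set L : ℝ → ℂ := fun v => -deriv (deriv f) v + (V v - ω ^ 2) * f v
  have hLc : Continuous L := by
    have h1 := hf.1.continuous
    have h2 := hf''.1.continuous
    fun_prop
  have hLs : HasCompactSupport L := hf''.2.neg.add (hf.2.mul_left (f := fun v => (V v : ℂ) - ω ^ 2))
  have hLi : ∀ ψ : ℝ → ℂ, Continuous ψ → Integrable fun v => ψ v * L v := fun ψ hψ =>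
    (hψ.mul hLc).integrable_of_hasCompactSupport hLs.mul_left
  have hW : ∀ {ψ ψ' : ℝ → ℂ}, IsODESolution (fun u => V u - ω ^ 2) ψ ψ' → ∀ v,
      HasDerivAt (fun v => ψ' v * f v - ψ v * deriv f v) (ψ v * L v) v := fun {ψ ψ'} h v => by
    refine (((h v).2.mul (hd v)).sub ((h v).1.mul (hd' v))).congr_deriv ?_
    simp only [L]
    ring
  have hz : ∀ {l : Filter ℝ} {ψ ψ' : ℝ → ℂ}, (∀ᶠ v in l, f v = 0) → (∀ᶠ v in l, deriv f v = 0) →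
      Tendsto (fun v => ψ' v * f v - ψ v * deriv f v) l (𝓝 0) := fun {l ψ ψ'} h1 h2 => by
    refine tendsto_const_nhds.congr' ?_
    filter_upwards [h1, h2] with v h3 h4
    simp [h3, h4]
  have hl : ∫ v in Iic u, φ v * L v = φ' u * f u - φ u * deriv f u := by
    rw [integral_Iic_of_hasDerivAt_of_tendsto' (fun v _ => hW g.sol_left v)
      (hLi φ g.sol_left.continuous).integrableOn
      (hz (testFun_eventually_atBot hf) (testFun_eventually_atBot hf')), sub_zero]
  have hr : ∫ v in Ioi u, χ v * L v = -(χ' u * f u - χ u * deriv f u) := by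
    rw [integral_Ioi_of_hasDerivAt_of_tendsto' (fun v _ => hW g.sol_right v)
      (hLi χ g.sol_right.continuous).integrableOn
      (hz (testFun_eventually_atTop hf) (testFun_eventually_atTop hf')), zero_sub]
  have hi := hLi _ (g.continuous_greenFunction u)
  rw [← integral_add_compl measurableSet_Iic hi, compl_Iic]
  have e1 : ∫ v in Iic u, greenFunction φ χ w u v * L v = -(1 / w) * χ u * ∫ v in Iic u, φ v * L v := by
    rw [← integral_const_mul]
    refine setIntegral_congr_fun measurableSet_Iic fun v hv => ?_
    rcases (show v ≤ u from hv).eq_or_lt with rfl | hv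
    · simp only [greenFunction, if_pos le_rfl]; ring
    · simp only [greenFunction, if_neg (not_le.mpr hv)]; ring
  have e2 : ∫ v in Ioi u, greenFunction φ χ w u v * L v = -(1 / w) * φ u * ∫ v in Ioi u, χ v * L v := by
    rw [← integral_const_mul]
    refine setIntegral_congr_fun measurableSet_Ioi fun v hv => ?_
    simp only [greenFunction, if_pos (show u ≤ v from le_of_lt hv)]; ring
  rw [e1, e2, hl, hr]
  have hw := g.wronskian u
  have := g.ne_zero
  field_simp
  linear_combination f u * hw

/-- `F` is the integral of the Green's function against `h`, in variation of parameters form. Beyond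
the support of `h` on the left only the `φ` term survives, on the right only the `χ` term, hence the
decay at both ends. -/
theorem exists_green_potential (g : IsGreenPair V ω a w φ φ' χ χ') {h : ℝ → ℂ}
    (hh : h ∈ testFun) : ∃ F F' : ℝ → ℂ, (∀ u, HasDerivAt F (F' u) u) ∧
      (∀ u, HasDerivAt F' ((V u - ω ^ 2) * F u - h u) u) ∧
      ∃ C, ∀ u, ‖F u‖ ≤ C * Real.exp (-a * |u|) ∧ ‖F' u‖ ≤ C * Real.exp (-a * |u|) := by
  obtain ⟨R, -, hR⟩ := hh.2.exists_pos_le_norm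
  have hhc := hh.1.continuous
  have hφc := g.sol_left.continuous
  have hχc := g.sol_right.continuous
  have hφh : Continuous fun v => φ v * h v := by fun_prop
  have hχh : Continuous fun v => χ v * h v := by fun_prop
  -- `h` vanishes outside `(-R, R)`, so these finite limits stand for `∓∞`.
  set P : ℝ → ℂ := fun u => ∫ v in (-R)..u, φ v * h v
  set Q : ℝ → ℂ := fun u => -∫ v in R..u, χ v * h v
  have hP : ∀ u, HasDerivAt P (φ u * h u) u := fun u =>
    (hφh.integral_hasStrictDerivAt _ u).hasDerivAt
  have hQ : ∀ u, HasDerivAt Q (-(χ u * h u)) u := fun u =>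
    (hχh.integral_hasStrictDerivAt _ u).hasDerivAt.neg
  have hbig : ∀ {ψ : ℝ → ℂ} (c : ℝ) (l : Filter ℝ), Continuous ψ →
      (fun u => ∫ v in c..u, ψ v * h v) =O[l] (1 : ℝ → ℝ) := fun {ψ} c l hψ => by
    refine Asymptotics.IsBigO.of_bound (∫ v, ‖ψ v * h v‖) (Eventually.of_forall fun u => ?_)
    rw [Pi.one_apply, norm_one, mul_one]
    exact intervalIntegral.norm_integral_le_integral_norm_uIoc.trans
      (setIntegral_le_integral ((hψ.mul hhc).integrable_of_hasCompactSupport hh.2.mul_left).norm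
        (ae_of_all _ fun _ => norm_nonneg _))
  have hPz : P =ᶠ[atBot] 0 := by
    filter_upwards [eventually_le_atBot (-R)] with u hu
    refine (intervalIntegral.integral_congr (g := fun _ => 0) fun v hv => ?_).trans (by simp)
    rw [uIcc_of_ge hu] at hv
    simp only [hR v ((le_neg_of_le_neg hv.2).trans (neg_le_abs v)), mul_zero]
  have hQz : Q =ᶠ[atTop] 0 := by
    filter_upwards [eventually_ge_atTop R] with u hu
    refine neg_eq_zero.mpr
      ((intervalIntegral.integral_congr (g := fun _ => 0) fun v hv => ?_).trans (by simp))
    rw [uIcc_of_le hu] at hv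
    simp only [hR v (hv.1.trans (le_abs_self v)), mul_zero]
  have hdecay : ∀ {ψ ξ : ℝ → ℂ}, Continuous ψ → Continuous ξ →
      (ψ =O[atBot] fun u => Real.exp (a * u)) → (ξ =O[atTop] fun u => Real.exp (-a * u)) →
      ∃ C, ∀ u, ‖-(1 / w) * (ξ u * P u + ψ u * Q u)‖ ≤ C * Real.exp (-a * |u|) :=
    fun {ψ ξ} hψ hξ h1 h2 => by
      have hPc : Continuous P := continuous_iff_continuousAt.mpr fun u => (hP u).continuousAt
      have hQc : Continuous Q := continuous_iff_continuousAt.mpr fun u => (hQ u).continuousAt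
      refine exists_exp_decay_bound (by fun_prop) ?_ ?_
      · refine Asymptotics.IsBigO.const_mul_left ?_ _
        refine ((h1.mul (hbig R atBot hχc).neg_left).congr' ?_ ?_ :)
        · filter_upwards [hPz] with u hu
          rw [hu, Pi.zero_apply, mul_zero, zero_add]
        · exact Eventually.of_forall fun u => mul_one _
      · refine Asymptotics.IsBigO.const_mul_left ?_ _
        refine ((h2.mul (hbig (-R) atTop hφc)).congr' ?_ ?_ :)
        · filter_upwards [hQz] with u hu
          rw [hu, Pi.zero_apply, mul_zero, add_zero]
        · exact Eventually.of_forall fun u => mul_one _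
  obtain ⟨C₁, hC₁⟩ := hdecay hφc hχc g.left g.right
  obtain ⟨C₂, hC₂⟩ := hdecay g.sol_left.continuous' g.sol_right.continuous' g.left' g.right'
  refine ⟨fun u => -(1 / w) * (χ u * P u + φ u * Q u),
    fun u => -(1 / w) * (χ' u * P u + φ' u * Q u), fun u => ?_, fun u => ?_,
    max C₁ C₂, fun u => ⟨(hC₁ u).trans ?_, (hC₂ u).trans ?_⟩⟩
  · refine ((((g.sol_right u).1.mul (hP u)).add
      ((g.sol_left u).1.mul (hQ u))).const_mul (-(1 / w))).congr_deriv ?_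
    ring
  · refine ((((g.sol_right u).2.mul (hP u)).add
      ((g.sol_left u).2.mul (hQ u))).const_mul (-(1 / w))).congr_deriv ?_
    have hw := g.wronskian u
    have := g.ne_zero
    field_simp
    linear_combination -h u * hw
  · gcongr; exact le_max_left _ _
  · gcongr; exact le_max_right _ _

/-- With `f(u) = η(δu) F(u)` the error consists of the commutator terms `δ² η'' F` and `2δ η' F'`,
small with `δ` and still exponentially decaying, hence small in `L²`. -/
theorem exists_testFun_approx (g : IsGreenPair V ω a w φ φ' χ χ')
    (hV : ContDiff ℝ (⊤ : ℕ∞) V) {h : ℝ → ℂ} (hh : h ∈ testFun) :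
    ∃ C, ∀ ε : ℝ, 0 < ε → ∃ f ∈ testFun, ∀ u,
      ‖-deriv (deriv f) u + (V u - ω ^ 2) * f u - h u‖ ≤ ε * (C * Real.exp (-a * |u|)) := by
  obtain ⟨F, F', hF, hF', C, hC⟩ := exists_green_potential g hh
  have hFs : ContDiff ℝ (⊤ : ℕ∞) F := by
    refine contDiff_of_hasDerivAt (q := fun u => V u - ω ^ 2) (h := fun u => -h u)
      ((Complex.ofRealCLM.contDiff.comp hV).sub contDiff_const) hh.1.neg hF fun u =>
      (hF' u).congr_deriv (by ring)
  have hF1 : deriv F = F' := funext fun u => (hF u).deriv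
  obtain ⟨R, hR0, hR⟩ := hh.2.exists_pos_le_norm
  let η₀ : ContDiffBump (0 : ℝ) := ⟨1, 2, one_pos, one_lt_two⟩
  set η : ℝ → ℂ := fun u => (η₀ u : ℂ)
  have hη : η ∈ testFun := ⟨Complex.ofRealCLM.contDiff.comp η₀.contDiff,
    η₀.hasCompactSupport.comp_left (g := fun x : ℝ => (x : ℂ)) Complex.ofReal_zero⟩
  have hη1 : ∀ u, |u| ≤ 1 → η u = 1 := fun u hu => by
    simp only [η]
    rw [η₀.one_of_mem_closedBall (by simpa using hu), Complex.ofReal_one]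
  have hηd := testFun_deriv hη
  have hηdd := testFun_deriv hηd
  obtain ⟨K₁, hK₁⟩ := hηd.2.exists_bound_of_continuous hηd.1.continuous
  obtain ⟨K₂, hK₂⟩ := hηdd.2.exists_bound_of_continuous hηdd.1.continuous
  have hK₁0 : 0 ≤ K₁ := (norm_nonneg _).trans (hK₁ 0)
  have hK₂0 : 0 ≤ K₂ := (norm_nonneg _).trans (hK₂ 0)
  refine ⟨(2 * K₁ + K₂) * C, fun ε hε => ?_⟩
  -- `δR ≤ 1` puts the support of `h` where the cutoff is 1; `δ ≤ 1` gives `δ² ≤ δ`.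
  obtain ⟨δ, hδ0, hδ1, hδε, hδR⟩ : ∃ δ : ℝ, 0 < δ ∧ δ ≤ 1 ∧ δ ≤ ε ∧ δ * R ≤ 1 :=
    ⟨min (min 1 ε) R⁻¹, by positivity, (min_le_left _ _).trans (min_le_left _ _),
      (min_le_left _ _).trans (min_le_right _ _), by
        calc _ ≤ R⁻¹ * R := by gcongr; exact min_le_right _ _
          _ = 1 := inv_mul_cancel₀ hR0.ne'⟩
  have hmul : ∀ u : ℝ, HasDerivAt (fun u => δ * u) δ u := fun u => by
    simpa using (hasDerivAt_id u).const_mul δ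
  have hs : ∀ {ζ : ℝ → ℂ}, ζ ∈ testFun → ∀ u,
      HasDerivAt (fun u => ζ (δ * u)) (δ * deriv ζ (δ * u)) u := fun {ζ} hζ u => by
    have := HasDerivAt.scomp u (testFun_differentiable hζ (δ * u)).hasDerivAt (hmul u)
    exact this.congr_deriv (by simp)
  set f : ℝ → ℂ := fun u => η (δ * u) * F u
  have hf1 : deriv f = fun u => δ * deriv η (δ * u) * F u + η (δ * u) * F' u :=
    funext fun u => ((hs hη u).mul (hF u)).deriv
  have hf2 : ∀ u, deriv (deriv f) u = δ ^ 2 * deriv (deriv η) (δ * u) * F u +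
      2 * δ * deriv η (δ * u) * F' u + η (δ * u) * ((V u - ω ^ 2) * F u - h u) := fun u => by
    rw [hf1]
    have := ((((hs hηd u).const_mul (δ : ℂ)).mul (hF u)).add ((hs hη u).mul (hF' u))).deriv
    refine (Eq.trans ?_ this).trans ?_
    · rfl
    · ring
  have hηs : HasCompactSupport fun u => η (δ * u) := by
    refine hη.2.comp_homeomorph (Homeomorph.mulLeft₀ δ hδ0.ne')
  refine ⟨f, ⟨(hη.1.comp (contDiff_const.mul contDiff_id)).mul hFs, hηs.mul_right⟩, fun u => ?_⟩
  have hηh : η (δ * u) * h u = h u := by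
    by_cases hu : R ≤ ‖u‖
    · rw [hR u hu, mul_zero]
    · rw [hη1, one_mul]
      rw [abs_mul, abs_of_pos hδ0]
      have : |u| ≤ R := (not_le.mp hu).le
      exact (mul_le_mul_of_nonneg_left this hδ0.le).trans hδR
  have e : -deriv (deriv f) u + (V u - ω ^ 2) * f u - h u =
      -(δ ^ 2 * deriv (deriv η) (δ * u) * F u + 2 * δ * deriv η (δ * u) * F' u) := by
    rw [hf2]
    simp only [f]
    linear_combination hηh
  rw [e, norm_neg]
  have hCe : 0 ≤ C * Real.exp (-a * |u|) := (norm_nonneg _).trans (hC u).1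
  calc _ ≤ δ ^ 2 * K₂ * (C * Real.exp (-a * |u|)) + 2 * δ * K₁ * (C * Real.exp (-a * |u|)) := by
        refine (norm_add_le _ _).trans ?_
        simp only [norm_mul, norm_pow, Complex.norm_real, Real.norm_of_nonneg hδ0.le,
          Complex.norm_ofNat]
        gcongr
        exacts [hK₂ _, (hC u).1, hK₁ _, (hC u).2]
    _ ≤ δ * K₂ * (C * Real.exp (-a * |u|)) + 2 * δ * K₁ * (C * Real.exp (-a * |u|)) := by
        gcongr
        nlinarith
    _ = δ * ((2 * K₁ + K₂) * C * Real.exp (-a * |u|)) := by ring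
    _ ≤ _ := by
        have : 0 ≤ (2 * K₁ + K₂) * C * Real.exp (-a * |u|) := by
          rw [mul_assoc]; positivity
        gcongr

end

/-! ### Jost solutions of the Regge-Wheeler equation -/

theorem jostExponent_sq (ω : ℂ) : jostExponent ω ^ 2 = -ω ^ 2 := by
  unfold jostExponent
  split_ifs <;> linear_combination ω ^ 2 * Complex.I_sq

theorem jostExponent_re (ω : ℂ) : (jostExponent ω).re = -|ω.im| := by
  unfold jostExponent
  split_ifs with h
  · simp [abs_of_pos h]
  · simp [abs_of_nonpos (not_lt.mp h)]

theorem jostExponent_re_neg {ω : ℂ} (hω : ω.im ≠ 0) : (jostExponent ω).re < 0 := by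
  rw [jostExponent_re]
  exact neg_lt_zero.mpr (abs_pos.mpr hω)

theorem IsODESolution.deriv_eq {q f f' : ℝ → ℂ} (h : IsODESolution q f f') : deriv f = f' :=
  funext fun u => (h u).1.deriv

theorem IsODESolution.deriv_eq' {q f f' : ℝ → ℂ} (h : IsODESolution q f f') :
    deriv f' = fun u => q u * f u :=
  funext fun u => (h u).2.deriv

theorem IsODESolution.comp_neg {q f f' : ℝ → ℂ} (h : IsODESolution q f f') :
    IsODESolution (fun u => q (-u)) (fun u => f (-u)) (fun u => -f' (-u)) := fun u => by
  have h1 := HasDerivAt.scomp u (h (-u)).1 (hasDerivAt_neg u)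
  have h2 := (HasDerivAt.scomp u (h (-u)).2 (hasDerivAt_neg u)).neg
  exact ⟨h1.congr_deriv (by simp), h2.congr_deriv (by simp)⟩

theorem isSchrodingerSolution_iff {M : ℝ} (hM : 0 < M) (l : ℕ) (ω : ℂ) (φ : ℝ → ℂ) :
    IsSchrodingerSolution M l ω φ ↔
      IsODESolution (fun u => potential M l u + jostExponent ω ^ 2) φ (deriv φ) := by
  rw [jostExponent_sq]
  constructor
  · rintro ⟨h1, h2⟩ u
    have h3 := (contDiff_succ_iff_deriv (n := 1)).mp h1
    have h4 : Differentiable ℝ (deriv φ) := h3.2.2.differentiable one_ne_zero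
    refine ⟨(h3.1 u).hasDerivAt, (h4 u).hasDerivAt.congr_deriv ?_⟩
    linear_combination -h2 u
  · intro h
    refine ⟨(contDiff_succ_iff_deriv (n := 1)).mpr ⟨fun u => (h u).1.differentiableAt, by simp,
      (contDiff_succ_iff_deriv (n := 0)).mpr ⟨fun u => (h u).2.differentiableAt, by simp, ?_⟩⟩,
      fun u => ?_⟩
    · rw [contDiff_zero, h.deriv_eq']
      have h1 := continuous_potential hM l
      have h2 := h.continuous
      fun_prop
    · rw [h.deriv_eq']
      ring

theorem tendsto_deriv_exp_mul_iff {κ : ℂ} {φ φ' : ℝ → ℂ} (h : ∀ u, HasDerivAt φ (φ' u) u)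
    {l : Filter ℝ} (hl : Tendsto (fun u : ℝ => Complex.exp (κ * u) * φ u) l (𝓝 1)) :
    Tendsto (deriv fun u : ℝ => Complex.exp (κ * u) * φ u) l (𝓝 0) ↔
      Tendsto (fun u : ℝ => Complex.exp (κ * u) * φ' u) l (𝓝 (-κ)) := by
  have e : (deriv fun u : ℝ => Complex.exp (κ * u) * φ u) = fun u : ℝ =>
      κ * (Complex.exp (κ * u) * φ u) + Complex.exp (κ * u) * φ' u := funext fun u =>
    (((hasDerivAt_exp_mul κ u).mul (h u)).congr_deriv (by ring)).deriv
  rw [e]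
  constructor
  · intro h1
    simpa using h1.sub (hl.const_mul κ)
  · intro h1
    simpa using (hl.const_mul κ).add h1

theorem isJostAtBot_iff {M : ℝ} (hM : 0 < M) (l : ℕ) (ω : ℂ) (φ : ℝ → ℂ) :
    IsJostAtBot M l ω φ ↔ IsJost (potential M l) (jostExponent ω) φ (deriv φ) := by
  rw [IsJostAtBot, isSchrodingerSolution_iff hM]
  constructor
  · rintro ⟨h1, h2, h3⟩
    exact ⟨h1, h2, (tendsto_deriv_exp_mul_iff (fun u => (h1 u).1) h2).mp h3⟩
  · rintro ⟨h1, h2, h3⟩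
    exact ⟨h1, h2, (tendsto_deriv_exp_mul_iff (fun u => (h1 u).1) h2).mpr h3⟩

/-- The reflection `u ↦ -u` exchanges the two ends, so the theory at `-∞` serves both; it also flips
the sign of the derivative. -/
theorem isJostAtTop_iff {M : ℝ} (hM : 0 < M) (l : ℕ) (ω : ℂ) (χ : ℝ → ℂ) :
    IsJostAtTop M l ω χ ↔ IsJost (fun u => potential M l (-u)) (jostExponent ω)
      (fun u => χ (-u)) (fun u => -deriv χ (-u)) := by
  have key : ∀ (f : ℝ → ℂ) (c : ℂ),
      Tendsto (fun u : ℝ => Complex.exp (-jostExponent ω * u) * f u) atTop (𝓝 c) ↔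
        Tendsto (fun u : ℝ => Complex.exp (jostExponent ω * u) * f (-u)) atBot (𝓝 c) := by
    intro f c
    rw [← map_neg_atBot, tendsto_map'_iff]
    simp [Function.comp_def]
  have key' : ∀ (f : ℝ → ℂ) (c : ℂ),
      Tendsto (fun u : ℝ => Complex.exp (jostExponent ω * u) * -f (-u)) atBot (𝓝 (-c)) ↔
        Tendsto (fun u : ℝ => Complex.exp (jostExponent ω * u) * f (-u)) atBot (𝓝 c) := by
    intro f c
    constructor <;> intro h <;> simpa using h.neg
  rw [IsJostAtTop, isSchrodingerSolution_iff hM]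
  constructor
  · rintro ⟨h1, h2, h3⟩
    rw [tendsto_deriv_exp_mul_iff (fun u => (h1 u).1) h2, neg_neg, key] at h3
    exact ⟨h1.comp_neg, (key _ _).mp h2, (key' _ _).mpr h3⟩
  · rintro ⟨h1, h2, h3⟩
    have h4 : IsODESolution (fun u => potential M l u + jostExponent ω ^ 2) χ (deriv χ) := by
      simpa using h1.comp_neg
    have h5 := (key _ _).mpr h2
    refine ⟨h4, h5, ?_⟩
    rw [tendsto_deriv_exp_mul_iff (fun u => (h4 u).1) h5, neg_neg, key]
    exact (key' _ _).mp h3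

theorem norm_potential_add_le {M : ℝ} (hM : 0 < M) (l : ℕ) (c : ℂ) (u : ℝ) :
    ‖(potential M l u : ℂ) + c‖ ≤ potentialBound M l + ‖c‖ := by
  refine (norm_add_le _ _).trans ?_
  rw [Complex.norm_real, Real.norm_of_nonneg (potential_pos hM l u).le]
  gcongr
  exact potential_le hM l u

theorem existsUnique_isJostAtBot {M : ℝ} (hM : 0 < M) (l : ℕ) {ω : ℂ} (hω : ω.im ≠ 0) :
    ∃! φ : ℝ → ℂ, IsJostAtBot M l ω φ := by
  have hκ := jostExponent_re_neg hω
  obtain ⟨φ, φ', h⟩ := exists_isJost (continuous_potential hM l)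
    (fun u => (potential_pos hM l u).le) (integrable_potential hM l) hκ
  refine ⟨φ, (isJostAtBot_iff hM l ω φ).mpr (by rwa [h.sol.deriv_eq]), fun χ hχ => ?_⟩
  exact h.unique hκ ((isJostAtBot_iff hM l ω χ).mp hχ) (norm_potential_add_le hM l _)

theorem existsUnique_isJostAtTop {M : ℝ} (hM : 0 < M) (l : ℕ) {ω : ℂ} (hω : ω.im ≠ 0) :
    ∃! χ : ℝ → ℂ, IsJostAtTop M l ω χ := by
  have hκ := jostExponent_re_neg hω
  obtain ⟨φ, φ', h⟩ := exists_isJost (V := fun u => potential M l (-u))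
    ((continuous_potential hM l).comp continuous_neg)
    (fun u => (potential_pos hM l _).le) (integrable_potential hM l).comp_neg hκ
  refine ⟨fun u => φ (-u), (isJostAtTop_iff hM l ω _).mpr ?_, fun χ hχ => ?_⟩
  · rw [h.sol.comp_neg.deriv_eq]
    simpa using h
  · have := h.unique hκ ((isJostAtTop_iff hM l ω χ).mp hχ) fun u =>
      norm_potential_add_le hM l _ (-u)
    funext u
    simpa using congrFun this (-u)

theorem isGreenPair_of_isJost {M : ℝ} (hM : 0 < M) (l : ℕ) {ω : ℂ} (hω : ω.im ≠ 0)
    {φ χ : ℝ → ℂ} (hφ : IsJostAtBot M l ω φ) (hχ : IsJostAtTop M l ω χ) :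
    IsGreenPair (potential M l) ω |ω.im| (wronskian φ χ 0) φ (deriv φ) χ (deriv χ) := by
  have hκ := jostExponent_re_neg hω
  have ha : 0 < |ω.im| := abs_pos.mpr hω
  have hφ' := (isJostAtBot_iff hM l ω φ).mp hφ
  have hχ' := (isJostAtTop_iff hM l ω χ).mp hχ
  have hre : -(jostExponent ω).re = |ω.im| := by rw [jostExponent_re, neg_neg]
  have hq : (fun u => (potential M l u : ℂ) + jostExponent ω ^ 2) =
      fun u => (potential M l u : ℂ) - ω ^ 2 := by
    funext u
    rw [jostExponent_sq]
    ring
  have hB := norm_potential_add_le hM l (jostExponent ω ^ 2)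
  have s1 := hφ'.sol
  have s2 := (isSchrodingerSolution_iff hM l ω χ).mp hχ.1
  have b1 := isBigO_exp_of_tendsto hφ'.lim
  have b1' := isBigO_exp_of_tendsto hφ'.lim'
  have b2 := (isBigO_exp_of_tendsto hχ'.lim).comp_tendsto tendsto_neg_atTop_atBot
  have b2' := (isBigO_exp_of_tendsto hχ'.lim').neg_left.comp_tendsto tendsto_neg_atTop_atBot
  rw [hre] at b1 b1' b2 b2'
  simp only [Function.comp_def, neg_neg, mul_neg, ← neg_mul] at b2 b2'
  have hw : ∀ u, φ u * deriv χ u - deriv φ u * χ u = wronskian φ χ 0 := fun u =>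
    s1.wronskian_const s2 u 0
  refine ⟨ha, hq ▸ s1, hq ▸ s2, b1, b1', b2, b2', hw, fun h0 => ?_⟩
  -- With zero Wronskian, `φ` is a multiple of `χ` and so decays at `+∞` as well as at `-∞`; then it
  -- must vanish, against its normalisation.
  have hχ0 : χ ≠ 0 := fun h => hχ'.ne_zero (funext fun u => congrFun h (-u))
  obtain ⟨c, hc⟩ := s1.exists_eq_mul hB s2 hχ0 h0
  have hc' : deriv φ = fun u => c * deriv χ u := funext fun u => by
    have := (s2 u).1.const_mul c
    rw [← hc] at this
    exact this.deriv
  have ht : Tendsto (fun u => Real.exp (-|ω.im| * u)) atTop (𝓝 0) := by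
    refine ((tendsto_exp_atBot_zero ha).comp tendsto_neg_atTop_atBot).congr fun u => ?_
    simp
  have l2 := (b2.trans_tendsto ht).const_mul c
  have l2' := (b2'.trans_tendsto ht).const_mul c
  rw [mul_zero] at l2 l2'
  refine hφ'.ne_zero (IsODESolution.eq_zero_of_tendsto hω (fun u => (potential_pos hM l u).le)
    (hq ▸ s1) (hφ'.tendsto_zero hκ) (hφ'.tendsto_zero' hκ) ?_ ?_)
  · rwa [← hc] at l2
  · rwa [← hc'] at l2'

/-! ### The resolvent of the closure of a symmetric operator -/

section

variable {E : Type*} [NormedAddCommGroup E] [InnerProductSpace ℂ E]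

/-- By symmetry `⟨x, S x⟩` is real, so the imaginary part of `⟨x, (S - ω) x⟩` is `-Im ω ‖x‖²`;
Cauchy–Schwarz concludes. -/
theorem im_mul_norm_le_of_isFormalAdjoint {S : E →ₗ.[ℂ] E} (hs : S.IsFormalAdjoint S) (ω : ℂ)
    (x : S.domain) : |ω.im| * ‖(x : E)‖ ≤ ‖S x - ω • (x : E)‖ := by
  have h1 : (inner ℂ (x : E) (S x)).im = 0 := by
    rw [← Complex.conj_eq_iff_im, inner_conj_symm]
    exact hs x x
  have h2 : (inner ℂ (x : E) (S x - ω • (x : E))).im = -(ω.im * ‖(x : E)‖ ^ 2) := by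
    rw [inner_sub_right, inner_smul_right, inner_self_eq_norm_sq_to_K, Complex.sub_im, h1]
    simp [← Complex.ofReal_pow]
  have h3 : |ω.im| * ‖(x : E)‖ ^ 2 ≤ ‖(x : E)‖ * ‖S x - ω • (x : E)‖ := by
    calc _ = |(inner ℂ (x : E) (S x - ω • (x : E))).im| := by
          rw [h2, abs_neg, abs_mul, abs_of_nonneg (sq_nonneg ‖(x : E)‖)]
      _ ≤ _ := (Complex.abs_im_le_norm _).trans (norm_inner_le_norm _ _)
  rcases (norm_nonneg (x : E)).eq_or_lt with h | h
  · rw [← h, mul_zero]; exact norm_nonneg _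
  · refine le_of_mul_le_mul_left ?_ h
    linarith

variable [CompleteSpace E]

/-- A densely defined symmetric operator is contained in its adjoint, which is closed. -/
theorem isClosable_of_isFormalAdjoint {S : E →ₗ.[ℂ] E} (hd : Dense (S.domain : Set E))
    (hs : S.IsFormalAdjoint S) : S.IsClosable :=
  (LinearPMap.adjoint_isClosed hd).isClosable.leIsClosable (hs.le_adjoint hd)

/-- The lower bound passes to the closed graph, giving injectivity and the norm bound `1 / |Im ω|`.
If `(S - ω) xₙ → y`, the bound makes `xₙ` Cauchy, so `S xₙ` converges as well and the limit pair
lies in the closed graph: the dense range becomes everything. -/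
theorem exists_isResolventAt_closure {S : E →ₗ.[ℂ] E} (hd : Dense (S.domain : Set E))
    (hs : S.IsFormalAdjoint S) {ω : ℂ} (hω : ω.im ≠ 0)
    (hr : Dense (range fun x : S.domain => S x - ω • (x : E))) :
    ∃ R : E →L[ℂ] E, IsResolventAt S.closure ω R := by
  have ha : 0 < |ω.im| := abs_pos.mpr hω
  have hg := (isClosable_of_isFormalAdjoint hd hs).graph_closure_eq_closure_graph
  have hbound : ∀ x : S.closure.domain,
      |ω.im| * ‖(x : E)‖ ≤ ‖S.closure x - ω • (x : E)‖ := fun x => by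
    have hx : ((x : E), S.closure x) ∈ closure (S.graph : Set (E × E)) := by
      have := S.closure.mem_graph x
      rwa [← hg, ← SetLike.mem_coe, Submodule.topologicalClosure_coe] at this
    have hc : IsClosed {p : E × E | |ω.im| * ‖p.1‖ ≤ ‖p.2 - ω • p.1‖} :=
      isClosed_le (by fun_prop) (by fun_prop)
    refine hc.closure_subset_iff.mpr ?_ hx
    rintro ⟨p, q⟩ hpq
    obtain ⟨y, rfl, rfl⟩ := (LinearPMap.mem_graph_iff S).mp hpq
    exact im_mul_norm_le_of_isFormalAdjoint hs ω y
  let L : S.closure.domain →ₗ[ℂ] E := S.closure.toFun - ω • S.closure.domain.subtype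
  have hL : ∀ x, L x = S.closure x - ω • (x : E) := fun x => rfl
  have hinj : Function.Injective L := by
    rw [← LinearMap.ker_eq_bot, LinearMap.ker_eq_bot']
    intro x hx
    have h1 := hbound x
    rw [← hL, hx, norm_zero] at h1
    have h2 : ‖(x : E)‖ ≤ 0 := by
      by_contra! h
      exact absurd h1 (not_le.mpr (mul_pos ha h))
    exact Subtype.ext (norm_le_zero_iff.mp h2)
  have hsurj : Function.Surjective L := fun y => by
    obtain ⟨z, hz, hzy⟩ := mem_closure_iff_seq_limit.mp (hr y)
    choose x hx using hz
    have hcau : CauchySeq fun n => (x n : E) := by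
      refine Metric.cauchySeq_iff.mpr fun ε hε => ?_
      obtain ⟨N, hN⟩ := Metric.cauchySeq_iff.mp hzy.cauchySeq (|ω.im| * ε) (by positivity)
      refine ⟨N, fun m hm n hn => ?_⟩
      have h1 := im_mul_norm_le_of_isFormalAdjoint hs ω (x m - x n)
      have h2 : S (x m - x n) - ω • ((x m - x n : S.domain) : E) = z m - z n := by
        rw [← hx, ← hx, S.map_sub, Submodule.coe_sub]
        module
      have h3 := hN m hm n hn
      rw [dist_eq_norm] at h3 ⊢
      rw [h2, Submodule.coe_sub] at h1
      exact lt_of_mul_lt_mul_left (h1.trans_lt h3) ha.le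
    obtain ⟨x₀, hx₀⟩ := cauchySeq_tendsto_of_complete hcau
    have hSx : Tendsto (fun n => S (x n)) atTop (𝓝 (y + ω • x₀)) := by
      refine (hzy.add (hx₀.const_smul ω)).congr fun n => ?_
      rw [← hx]
      simp
    have hmem : (x₀, y + ω • x₀) ∈ S.closure.graph := by
      rw [← hg, ← SetLike.mem_coe, Submodule.topologicalClosure_coe]
      exact mem_closure_of_tendsto (hx₀.prodMk_nhds hSx)
        (Eventually.of_forall fun n => S.mem_graph (x n))
    obtain ⟨x', hx'1, hx'2⟩ := (LinearPMap.mem_graph_iff _).mp hmem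
    refine ⟨x', ?_⟩
    rw [hL, hx'2, hx'1]
    simp
  let e := LinearEquiv.ofBijective L ⟨hinj, hsurj⟩
  refine ⟨(S.closure.domain.subtype ∘ₗ e.symm.toLinearMap).mkContinuous |ω.im|⁻¹ fun y => ?_,
    fun x => ?_, fun y => ⟨(e.symm y).2, ?_⟩⟩
  · have h1 := hbound (e.symm y)
    have h2 : L (e.symm y) = y := e.apply_symm_apply y
    rw [← hL, h2] at h1
    rw [inv_mul_eq_div, le_div_iff₀ ha, mul_comm]
    exact h1
  · exact congrArg Subtype.val (e.symm_apply_apply x)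
  · exact e.apply_symm_apply y

end

/-! ### Completeness of the energy space -/

theorem integral_mul_eq_inner_star {μ : Measure ℝ} {k : ℝ → ℂ} (hk : MemLp k 2 μ)
    (f : Lp ℂ 2 μ) : ∫ u, f u * k u ∂μ = inner ℂ (hk.star.toLp (star k)) f := by
  rw [L2.inner_def]
  refine integral_congr_ae ?_
  filter_upwards [hk.star.coeFn_toLp] with u hu
  rw [hu]
  simp

theorem continuous_integral_mul_Lp {μ : Measure ℝ} {k : ℝ → ℂ} (hk : MemLp k 2 μ) :
    Continuous fun f : Lp ℂ 2 μ => ∫ u, f u * k u ∂μ := by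
  simp only [integral_mul_eq_inner_star hk]
  fun_prop

theorem norm_integral_mul_Lp_le {μ : Measure ℝ} {k : ℝ → ℂ} (hk : MemLp k 2 μ) (f : Lp ℂ 2 μ) :
    ‖∫ u, f u * k u ∂μ‖ ≤ ‖hk.star.toLp (star k)‖ * ‖f‖ := by
  rw [integral_mul_eq_inner_star hk]
  exact norm_inner_le_norm _ _

theorem norm_setIntegral_Lp_le {s : Set ℝ} (hs : MeasurableSet s) (hμs : volume s ≠ ∞)
    (f : Lp ℂ 2 (volume : Measure ℝ)) : ‖∫ u in s, f u‖ ≤ √(volume.real s) * ‖f‖ := by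
  rw [← L2.inner_indicatorConstLp_one (𝕜 := ℂ) hs hμs f]
  refine (norm_inner_le_norm _ _).trans_eq ?_
  rw [norm_indicatorConstLp two_ne_zero ENNReal.ofNat_ne_top, norm_one, one_mul, Real.sqrt_eq_rpow]
  simp

section

variable {M : ℝ} (hM : 0 < M) (l : ℕ)

include hM

theorem integral_potentialMeasure (f : ℝ → ℂ) :
    ∫ u, f u ∂potentialMeasure M l = ∫ u, (potential M l u : ℂ) * f u := by
  rw [potentialMeasure, integral_withDensity_eq_integral_toReal_smul
    (measurable_potential hM l).ennreal_ofReal (ae_of_all _ fun u => ENNReal.ofReal_lt_top)]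
  refine integral_congr_ae (ae_of_all _ fun u => ?_)
  simp only [ENNReal.toReal_ofReal (potential_pos hM l u).le, Complex.real_smul]

theorem integrable_potentialMeasure_iff (f : ℝ → ℂ) :
    Integrable f (potentialMeasure M l) ↔ Integrable fun u => (potential M l u : ℂ) * f u := by
  rw [potentialMeasure, integrable_withDensity_iff_integrable_smul'
    (measurable_potential hM l).ennreal_ofReal (ae_of_all _ fun u => ENNReal.ofReal_lt_top)]
  refine integrable_congr (ae_of_all _ fun u => ?_)
  simp only [ENNReal.toReal_ofReal (potential_pos hM l u).le, Complex.real_smul]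

/-- Dividing the test factor by `V` turns a `du` pairing into one on `L²(V du)`; on compact sets
`1/V` is bounded. -/
theorem potential_mul_div (f k : ℝ → ℂ) (u : ℝ) :
    (potential M l u : ℂ) * (f u * (k u / potential M l u)) = f u * k u := by
  have : (potential M l u : ℂ) ≠ 0 := by exact_mod_cast (potential_pos hM l u).ne'
  field_simp

theorem integral_mul_eq_potentialMeasure (f k : ℝ → ℂ) :
    ∫ u, f u * k u = ∫ u, f u * (k u / potential M l u) ∂potentialMeasure M l := by
  rw [integral_potentialMeasure hM]
  simp only [potential_mul_div hM]

theorem memLp_div_potential_of_testFun {k : ℝ → ℂ} (hk : k ∈ testFun) :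
    MemLp (fun u => k u / potential M l u) 2 (potentialMeasure M l) := by
  have hV : ∀ u, (potential M l u : ℂ) ≠ 0 := fun u => by
    exact_mod_cast (potential_pos hM l u).ne'
  have hc : Continuous fun u => k u / potential M l u :=
    hk.1.continuous.div (by have := continuous_potential hM l; fun_prop) hV
  have hs : HasCompactSupport fun u => k u / (potential M l u : ℂ) := by
    simp only [div_eq_mul_inv]
    exact hk.2.mul_right
  exact (hc.memLp_of_hasCompactSupport hs).of_measure_le_smul ENNReal.ofReal_ne_top
    (potentialMeasure_le hM l)

theorem memLp_indicator_div_potential {K : Set ℝ} (hK : IsCompact K) :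
    MemLp (fun u => K.indicator (1 : ℝ → ℂ) u / potential M l u) 2 (potentialMeasure M l) := by
  have hV : ∀ u, (potential M l u : ℂ) ≠ 0 := fun u => by
    exact_mod_cast (potential_pos hM l u).ne'
  have hc : Continuous fun u => 1 / (potential M l u : ℂ) :=
    continuous_const.div (by have := continuous_potential hM l; fun_prop) hV
  obtain ⟨C, hC⟩ := (hK.image hc).isBounded.exists_norm_le
  have h1 : MemLp (K.indicator fun u => 1 / (potential M l u : ℂ)) 2 volume := by
    refine (memLp_indicator_iff_restrict hK.measurableSet).mpr ?_
    have : IsFiniteMeasure (volume.restrict K) := ⟨by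
      rw [Measure.restrict_apply_univ]; exact hK.measure_lt_top⟩
    refine MemLp.of_bound hc.aestronglyMeasurable C ?_
    filter_upwards [ae_restrict_mem hK.measurableSet] with u hu
    exact hC _ (mem_image_of_mem _ hu)
  refine (h1.of_measure_le_smul ENNReal.ofReal_ne_top
    (potentialMeasure_le hM l)).ae_eq (ae_of_all _ fun u => ?_)
  by_cases hu : u ∈ K <;> simp [hu]

theorem locallyIntegrable_of_Lp_potential (f : Lp ℂ 2 (potentialMeasure M l)) :
    LocallyIntegrable f := by
  rw [locallyIntegrable_iff]
  intro K hK
  have h1 := (Lp.memLp f).integrable_mul (memLp_indicator_div_potential hM l hK)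
  rw [integrable_potentialMeasure_iff hM] at h1
  simp only [Pi.mul_apply, potential_mul_div hM] at h1
  rw [← integrable_indicator_iff hK.measurableSet]
  refine h1.congr (ae_of_all _ fun u => ?_)
  by_cases hu : u ∈ K <;> simp [hu]

/-- Each test function imposes an equation between continuous functionals of the pair; local
integrability holds automatically. -/
theorem isClosed_H1V : IsClosed (H1V hM l : Set (WithLp 2 (Lp ℂ 2 (potentialMeasure M l) ×
    Lp ℂ 2 (volume : Measure ℝ)))) := by
  have h : (H1V hM l : Set (WithLp 2 (Lp ℂ 2 (potentialMeasure M l) ×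
      Lp ℂ 2 (volume : Measure ℝ)))) = ⋂ η : testFun, {x | ∫ u, x.fst u * deriv η.1 u =
        -∫ u, x.snd u * η.1 u} := by
    ext x
    simp only [mem_iInter]
    constructor
    · intro hx η
      exact hx.2.2 η.1 η.2
    · intro hx
      refine ⟨locallyIntegrable_of_Lp_potential hM l x.fst,
        (Lp.memLp x.snd).locallyIntegrable one_le_two, fun η hη => hx ⟨η, hη⟩⟩
  rw [h]
  refine isClosed_iInter fun η => isClosed_eq ?_ ?_
  · simp only [integral_mul_eq_potentialMeasure hM l]
    exact (continuous_integral_mul_Lp (memLp_div_potential_of_testFun hM l (testFun_deriv η.2))).comp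
      (WithLp.continuous_fst _ _ _)
  · exact ((continuous_integral_mul_Lp (testFun_memLp η.2)).comp (WithLp.continuous_snd _ _ _)).neg

theorem completeSpace_H1V : CompleteSpace (H1V hM l) :=
  (isClosed_H1V hM l).completeSpace_coe

theorem completeSpace_H1V0 : CompleteSpace (H1V0 hM l) :=
  have := completeSpace_H1V hM l
  (Submodule.isClosed_topologicalClosure _).completeSpace_coe

theorem completeSpace_energySpace : CompleteSpace (EnergySpace hM l) :=
  have := completeSpace_H1V0 hM l
  inferInstanceAs (CompleteSpace (WithLp 2 (H1V0 hM l × Lp ℂ 2 (volume : Measure ℝ))))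

/-! ### Test functions in the energy space -/

theorem denseRange_testToH1V0 : DenseRange (testToH1V0 hM l) := by
  intro x
  rw [closure_subtype]
  have hx : (x : H1V hM l) ∈ (LinearMap.range (testToH1V hM l)).topologicalClosure := x.2
  rw [← SetLike.mem_coe, Submodule.topologicalClosure_coe] at hx
  refine closure_mono ?_ hx
  rintro _ ⟨f, rfl⟩
  exact ⟨testToH1V0 hM l f, mem_range_self f, rfl⟩

omit hM in
theorem denseRange_testToL2 : DenseRange testToL2 := by
  refine (Lp.dense_hasCompactSupport_contDiff (F := ℂ) (μ := (volume : Measure ℝ)) (p := 2)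
    ENNReal.ofNat_ne_top).mono ?_
  rintro f ⟨g, hfg, hg, hg'⟩
  refine ⟨⟨g, hg', hg⟩, ?_⟩
  exact Lp.ext ((testFun_memLp (f := g) ⟨hg', hg⟩).coeFn_toLp.trans hfg.symm)

theorem denseRange_testToEnergy : DenseRange (testToEnergy hM l) := by
  have h := (denseRange_testToH1V0 hM l).prodMap denseRange_testToL2
  exact (WithLp.toLp_surjective 2).denseRange.comp h (WithLp.prod_continuous_toLp 2 _ _)

omit hM in
theorem inner_testToL2 (f : testFun) {g : ℝ → ℂ} (hg : MemLp g 2 (volume : Measure ℝ)) :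
    inner ℂ (testToL2 f) (hg.toLp g) = ∫ u, starRingEnd ℂ (f.1 u) * g u := by
  rw [L2.inner_def]
  refine integral_congr_ae ?_
  filter_upwards [(testFun_memLp f.2).coeFn_toLp, hg.coeFn_toLp] with u h1 h2
  have h3 : testToL2 f u = f.1 u := h1
  rw [h2, h3, RCLike.inner_apply, mul_comm]

theorem inner_testToH1V0 (f g : testFun) : inner ℂ (testToH1V0 hM l f) (testToH1V0 hM l g) =
    (∫ u, (potential M l u : ℂ) * (starRingEnd ℂ (f.1 u) * g.1 u)) +
      ∫ u, starRingEnd ℂ (deriv f.1 u) * deriv g.1 u := by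
  have e : inner ℂ (testToH1V0 hM l f) (testToH1V0 hM l g) =
      inner ℂ ((testFun_memLp_potential hM l f.2).toLp f.1)
        ((testFun_memLp_potential hM l g.2).toLp g.1) +
      inner ℂ ((testFun_memLp (testFun_deriv f.2)).toLp (deriv f.1))
        ((testFun_memLp (testFun_deriv g.2)).toLp (deriv g.1)) := rfl
  rw [e]
  congr 1
  · rw [← integral_potentialMeasure hM, L2.inner_def]
    refine integral_congr_ae ?_
    filter_upwards [(testFun_memLp_potential hM l f.2).coeFn_toLp,
      (testFun_memLp_potential hM l g.2).coeFn_toLp] with u h1 h2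
    rw [h1, h2, RCLike.inner_apply, mul_comm]
  · exact inner_testToL2 ⟨deriv f.1, testFun_deriv f.2⟩ _

/-- One integration by parts; this is the source of the symmetry of the Hamiltonian. -/
theorem inner_schrodinger (f g : testFun) :
    inner ℂ (testToL2 f) (schrodinger hM l g) =
      inner ℂ (testToH1V0 hM l f) (testToH1V0 hM l g) := by
  have hf' := testFun_deriv f.2
  have hg' := testFun_deriv g.2
  have hg'' := testFun_deriv hg'
  have e : inner ℂ (testToL2 f) (schrodinger hM l g) =
      ∫ u, starRingEnd ℂ (f.1 u) * (-deriv (deriv g.1) u + (potential M l u : ℂ) * g.1 u) :=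
    inner_testToL2 f (schrodinger_memLp hM l g.2)
  have hint : ∀ {p q : ℝ → ℂ}, p ∈ testFun → q ∈ testFun →
      Integrable fun u => starRingEnd ℂ (p u) * q u := fun {p q} hp hq =>
    testFun_integrable_mul (Complex.continuous_conj.comp hp.1.continuous).locallyIntegrable hq
  have hibp : ∫ u, starRingEnd ℂ (f.1 u) * deriv (deriv g.1) u =
      -∫ u, starRingEnd ℂ (deriv f.1 u) * deriv g.1 u :=
    integral_mul_deriv_eq_deriv_mul_of_integrable
      (fun u _ => (testFun_differentiable f.2 u).hasDerivAt.star)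
      (fun u _ => (testFun_differentiable hg' u).hasDerivAt) (hint f.2 hg'') (hint hf' hg')
      (hint f.2 hg')
  have hV : Integrable fun u => (potential M l u : ℂ) * (starRingEnd ℂ (f.1 u) * g.1 u) := by
    refine (hint f.2 g.2).bdd_mul (c := potentialBound M l) ?_ (ae_of_all _ fun u => ?_)
    · have := continuous_potential hM l
      fun_prop
    · rw [Complex.norm_real, Real.norm_of_nonneg (potential_pos hM l u).le]
      exact potential_le hM l u
  have e2 : (fun u => starRingEnd ℂ (f.1 u) *
      (-deriv (deriv g.1) u + (potential M l u : ℂ) * g.1 u)) = fun u =>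
      (potential M l u : ℂ) * (starRingEnd ℂ (f.1 u) * g.1 u) -
        starRingEnd ℂ (f.1 u) * deriv (deriv g.1) u := funext fun u => by ring
  rw [e, inner_testToH1V0, e2, integral_sub hV (hint f.2 hg''), hibp, sub_neg_eq_add]

theorem hamiltonianMin_apply (p : testFun × testFun)
    (h : testToEnergy hM l p ∈ (hamiltonianMin hM l).domain) :
    hamiltonianMin hM l ⟨testToEnergy hM l p, h⟩ = hamiltonianAction hM l p := by
  have : (LinearEquiv.ofInjective (testToEnergy hM l) (testToEnergy_injective hM l)).symm
      ⟨testToEnergy hM l p, h⟩ = p := by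
    rw [LinearEquiv.symm_apply_eq]
    rfl
  exact congrArg (hamiltonianAction hM l) this

theorem inner_energySpace (x y : EnergySpace hM l) :
    inner ℂ x y = inner ℂ x.fst y.fst + inner ℂ x.snd y.snd := rfl

/-- The Hamiltonian swaps the two components, so `inner_schrodinger` turns each summand on the left
into the other summand on the right. -/
theorem inner_hamiltonianAction (p q : testFun × testFun) :
    inner ℂ (hamiltonianAction hM l p) (testToEnergy hM l q) =
      inner ℂ (testToEnergy hM l p) (hamiltonianAction hM l q) := by
  have e1 : inner ℂ (hamiltonianAction hM l p) (testToEnergy hM l q) =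
      inner ℂ (testToH1V0 hM l p.2) (testToH1V0 hM l q.1) +
        inner ℂ (schrodinger hM l p.1) (testToL2 q.2) := inner_energySpace hM l _ _
  have e2 : inner ℂ (testToEnergy hM l p) (hamiltonianAction hM l q) =
      inner ℂ (testToH1V0 hM l p.1) (testToH1V0 hM l q.2) +
        inner ℂ (testToL2 p.2) (schrodinger hM l q.1) := inner_energySpace hM l _ _
  have e3 : inner ℂ (schrodinger hM l p.1) (testToL2 q.2) =
      inner ℂ (testToH1V0 hM l p.1) (testToH1V0 hM l q.2) := by
    have h := inner_conj_symm (𝕜 := ℂ) (schrodinger hM l p.1) (testToL2 q.2)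
    have h' := inner_conj_symm (𝕜 := ℂ) (testToH1V0 hM l p.1) (testToH1V0 hM l q.2)
    exact h.symm.trans ((congrArg _ (inner_schrodinger hM l q.2 p.1)).trans h')
  have e4 := inner_schrodinger hM l p.2 q.1
  exact e1.trans ((congrArg₂ _ e4.symm e3).trans ((add_comm _ _).trans e2.symm))

theorem isFormalAdjoint_hamiltonianMin :
    (hamiltonianMin hM l).IsFormalAdjoint (hamiltonianMin hM l) := by
  rintro ⟨x, hx⟩ ⟨y, hy⟩
  obtain ⟨p, hp⟩ := LinearMap.mem_range.mp hx
  obtain ⟨q, hq⟩ := LinearMap.mem_range.mp hy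
  subst hp hq
  rw [hamiltonianMin_apply, hamiltonianMin_apply]
  exact inner_hamiltonianAction hM l p q

/-! ### A pointwise bound on the energy space -/

/-- The potential decays at both ends, so the norm does not control `f` in `L²`. It does control the
mean of `f` over `[0, 1]`, where `1/V` is bounded, and by Cauchy–Schwarz on `f'` the difference of
`f u` from that mean. -/
theorem exists_testFun_bound : ∃ C, 0 ≤ C ∧ ∀ (f : testFun) (u : ℝ),
    ‖f.1 u‖ ≤ C * (1 + |u|) * ‖testToH1V0 hM l f‖ := by
  have hK := memLp_indicator_div_potential hM l (isCompact_Icc (a := (0 : ℝ)) (b := 1))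
  set A := ‖hK.star.toLp _‖
  refine ⟨1 + A, by positivity, fun f u => ?_⟩
  set F := (testFun_memLp_potential hM l f.2).toLp f.1
  set F' := (testFun_memLp (testFun_deriv f.2)).toLp (deriv f.1)
  have hF : ‖F‖ ≤ ‖testToH1V0 hM l f‖ := WithLp.norm_fst_le _ (testToH1V0 hM l f).1.1
  have hF' : ‖F'‖ ≤ ‖testToH1V0 hM l f‖ := WithLp.norm_snd_le _ (testToH1V0 hM l f).1.1
  have hFf : ∀ᵐ v, F v = f.1 v :=
    (volume_absolutelyContinuous hM l).ae_le (testFun_memLp_potential hM l f.2).coeFn_toLp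
  have hfc := f.2.1.continuous
  have h1 : ‖∫ v in Icc (0 : ℝ) 1, f.1 v‖ ≤ A * ‖F‖ := by
    have h2 := norm_integral_mul_Lp_le hK F
    rw [← integral_mul_eq_potentialMeasure hM] at h2
    refine le_trans (le_of_eq ?_) h2
    rw [← integral_indicator measurableSet_Icc]
    congr 1
    refine integral_congr_ae ?_
    filter_upwards [hFf] with v hv
    rw [hv]
    by_cases hv' : v ∈ Icc (0 : ℝ) 1 <;> simp [hv']
  have h2 : ∀ v ∈ Icc (0 : ℝ) 1, ‖f.1 u - f.1 v‖ ≤ (1 + |u|) * ‖F'‖ := fun v hv => by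
    have h3 : f.1 u - f.1 v = ∫ t in v..u, deriv f.1 t :=
      (intervalIntegral.integral_deriv_eq_sub (fun t _ => testFun_differentiable f.2 t)
        ((testFun_deriv f.2).1.continuous.intervalIntegrable _ _)).symm
    have h4 : ∫ t in uIoc v u, deriv f.1 t = ∫ t in uIoc v u, F' t :=
      integral_congr_ae (ae_restrict_of_ae
        ((testFun_memLp (testFun_deriv f.2)).coeFn_toLp.symm))
    -- Crude but sufficient: `|u - v| ≤ 1 + |u| ≤ (1 + |u|)²`.
    have h5 : √(volume.real (uIoc v u)) ≤ 1 + |u| := by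
      rw [Real.sqrt_le_left (by positivity)]
      have : volume.real (uIoc v u) = |u - v| := by
        rw [measureReal_def, Real.volume_uIoc, ENNReal.toReal_ofReal (abs_nonneg _)]
      rw [this]
      have h6 : |u - v| ≤ |u| + 1 := by
        refine (abs_sub _ _).trans ?_
        rw [abs_of_nonneg hv.1]
        linarith [hv.2]
      nlinarith [abs_nonneg u]
    rw [h3, intervalIntegral.norm_intervalIntegral_eq, h4]
    refine (norm_setIntegral_Lp_le measurableSet_uIoc ?_ F').trans (by gcongr)
    rw [Real.volume_uIoc]
    exact ENNReal.ofReal_ne_top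
  have h3 : f.1 u = (∫ v in Icc (0 : ℝ) 1, (f.1 u - f.1 v)) + ∫ v in Icc (0 : ℝ) 1, f.1 v := by
    rw [← integral_add]
    · simp
    · exact (continuous_const.sub hfc).integrableOn_Icc
    · exact hfc.integrableOn_Icc
  have h4 : ‖∫ v in Icc (0 : ℝ) 1, (f.1 u - f.1 v)‖ ≤ (1 + |u|) * ‖F'‖ := by
    have := norm_setIntegral_le_of_norm_le_const (μ := volume) (s := Icc (0 : ℝ) 1) (by simp) h2
    simpa using this
  calc ‖f.1 u‖ ≤ (1 + |u|) * ‖F'‖ + A * ‖F‖ := by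
        rw [h3]
        exact (norm_add_le _ _).trans (add_le_add h4 h1)
    _ ≤ (1 + |u|) * ‖testToH1V0 hM l f‖ + A * (1 + |u|) * ‖testToH1V0 hM l f‖ := by
        gcongr
        have : 0 ≤ A := norm_nonneg _
        nlinarith [abs_nonneg u]
    _ = _ := by ring

/-- Convergence in `L²` yields almost everywhere convergence along a subsequence, taken for one
component and then refined for the other. Null sets of `V du` and `du` agree, as `V > 0`. -/
theorem exists_subseq_eval_tendsto {x : ℕ → EnergySpace hM l} {y : EnergySpace hM l}
    (h : Tendsto x atTop (𝓝 y)) : ∃ ns : ℕ → ℕ, StrictMono ns ∧ ∀ᵐ u,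
      Tendsto (fun n => (x (ns n)).fst.1.1.fst u) atTop (𝓝 (y.fst.1.1.fst u)) ∧
      Tendsto (fun n => (x (ns n)).snd u) atTop (𝓝 (y.snd u)) := by
  have c1 : Continuous fun z : EnergySpace hM l => z.fst.1.1.fst :=
    (WithLp.continuous_fst _ _ _).comp (continuous_subtype_val.comp
      (continuous_subtype_val.comp (WithLp.continuous_fst _ _ _)))
  have c2 : Continuous fun z : EnergySpace hM l => z.snd := WithLp.continuous_snd _ _ _
  obtain ⟨ns, hns, h1⟩ := (tendstoInMeasure_of_tendsto_Lp
    ((c1.tendsto y).comp h)).exists_seq_tendsto_ae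
  obtain ⟨ms, hms, h2⟩ := (tendstoInMeasure_of_tendsto_Lp
    ((c2.tendsto y).comp (h.comp hns.tendsto_atTop))).exists_seq_tendsto_ae
  refine ⟨ns ∘ ms, hns.comp hms, ?_⟩
  filter_upwards [(volume_absolutelyContinuous hM l).ae_le h1, h2] with u h3 h4
  exact ⟨h3.comp hms.tendsto_atTop, h4⟩

theorem exists_energySpace_bound : ∃ C, 0 ≤ C ∧ ∀ Ψ : EnergySpace hM l, ∀ᵐ u,
    ‖Ψ.fst.1.1.fst u‖ ≤ C * (1 + |u|) * ‖Ψ‖ := by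
  obtain ⟨C, hC0, hC⟩ := exists_testFun_bound hM l
  refine ⟨C, hC0, fun Ψ => ?_⟩
  obtain ⟨x, hx, hxΨ⟩ := mem_closure_iff_seq_limit.mp (denseRange_testToEnergy hM l Ψ)
  choose p hp using hx
  obtain ⟨ns, hns, hae⟩ := exists_subseq_eval_tendsto hM l hxΨ
  have h1 : ∀ n, ∀ᵐ u, (x n).fst.1.1.fst u = (p n).1.1 u := fun n => by
    rw [← hp]
    exact (volume_absolutelyContinuous hM l).ae_le
      (testFun_memLp_potential hM l (p n).1.2).coeFn_toLp
  filter_upwards [hae, ae_all_iff.mpr h1] with u h2 h3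
  refine le_of_tendsto_of_tendsto h2.1.norm
    ((hxΨ.norm.comp hns.tendsto_atTop).const_mul (C * (1 + |u|)))
    (Eventually.of_forall fun n => ?_)
  simp only [Function.comp_apply]
  rw [h3]
  refine (hC _ u).trans ?_
  gcongr
  rw [← hp]
  exact WithLp.norm_fst_le _ (testToEnergy hM l (p (ns n)))

end

/-! ### The resolvent of the Hamiltonian -/

theorem dist_toLp_mk_left {E F : Type*} [NormedAddCommGroup E] [NormedAddCommGroup F] (x : E)
    (y z : F) : dist (WithLp.toLp 2 (x, y)) (WithLp.toLp 2 (x, z)) = dist y z := by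
  rw [dist_eq_norm, ← WithLp.toLp_sub, Prod.mk_sub_mk, sub_self, WithLp.norm_toLp_snd,
    dist_eq_norm]

theorem IsResolventAt.apply_of_closure {E : Type*} [NormedAddCommGroup E] [NormedSpace ℂ E]
    {S : E →ₗ.[ℂ] E} {ω : ℂ} {R : E →L[ℂ] E} (hR : IsResolventAt S.closure ω R) (x : S.domain) :
    R (S x - ω • (x : E)) = x := by
  have hle := LinearPMap.le_closure S
  have h1 : S.closure ⟨x, hle.1 x.2⟩ = S x := (hle.2 rfl).symm
  rw [← h1]
  exact hR.1 ⟨x, hle.1 x.2⟩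

section

variable {M : ℝ} (hM : 0 < M) (l : ℕ)

/-- `(H - ω)(ψ₁, ψ₂)` for test functions `ψ₁, ψ₂`. -/
noncomputable def hamiltonianShift (ω : ℂ) (p : testFun × testFun) : EnergySpace hM l :=
  WithLp.toLp 2 (testToH1V0 hM l (p.2 - ω • p.1), schrodinger hM l p.1 - ω • testToL2 p.2)

theorem hamiltonianMin_sub_smul (ω : ℂ) (p : testFun × testFun)
    (h : testToEnergy hM l p ∈ (hamiltonianMin hM l).domain) :
    hamiltonianMin hM l ⟨testToEnergy hM l p, h⟩ - ω • testToEnergy hM l p =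
      hamiltonianShift hM l ω p := by
  rw [hamiltonianMin_apply, hamiltonianShift, map_sub, map_smul]
  rfl

theorem range_hamiltonianMin_sub_smul (ω : ℂ) :
    (range fun x : (hamiltonianMin hM l).domain =>
      hamiltonianMin hM l x - ω • (x : EnergySpace hM l)) = range (hamiltonianShift hM l ω) := by
  ext y
  constructor
  · rintro ⟨⟨x, hx⟩, rfl⟩
    obtain ⟨p, hp⟩ := LinearMap.mem_range.mp hx
    subst hp
    exact ⟨p, (hamiltonianMin_sub_smul hM l ω p hx).symm⟩
  · rintro ⟨p, rfl⟩
    exact ⟨⟨testToEnergy hM l p, LinearMap.mem_range_self _ _⟩,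
      hamiltonianMin_sub_smul hM l ω p (LinearMap.mem_range_self _ _)⟩

theorem testToEnergy_fst_ae (p : testFun × testFun) :
    ∀ᵐ u, (testToEnergy hM l p).fst.1.1.fst u = p.1.1 u :=
  (volume_absolutelyContinuous hM l).ae_le (testFun_memLp_potential hM l p.1.2).coeFn_toLp

theorem testToL2_ae (f : testFun) : ∀ᵐ u, testToL2 f u = f.1 u :=
  (testFun_memLp f.2).coeFn_toLp

theorem testToEnergy_snd_ae (p : testFun × testFun) :
    ∀ᵐ u, (testToEnergy hM l p).snd u = p.2.1 u :=
  testToL2_ae p.2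

theorem schrodinger_ae (f : testFun) : ∀ᵐ u,
    schrodinger hM l f u = -deriv (deriv f.1) u + (potential M l u : ℂ) * f.1 u :=
  (schrodinger_memLp hM l f.2).coeFn_toLp

theorem hamiltonianShift_fst_ae (ω : ℂ) (p : testFun × testFun) :
    ∀ᵐ u, (hamiltonianShift hM l ω p).fst.1.1.fst u = p.2.1 u - ω * p.1.1 u :=
  (volume_absolutelyContinuous hM l).ae_le
    (testFun_memLp_potential hM l (p.2 - ω • p.1).2).coeFn_toLp

theorem hamiltonianShift_snd_ae (ω : ℂ) (p : testFun × testFun) :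
    ∀ᵐ u, (hamiltonianShift hM l ω p).snd u =
      -deriv (deriv p.1.1) u + (potential M l u : ℂ) * p.1.1 u - ω * p.2.1 u := by
  have h : (hamiltonianShift hM l ω p).snd = schrodinger hM l p.1 - ω • testToL2 p.2 := rfl
  rw [h]
  filter_upwards [Lp.coeFn_sub (schrodinger hM l p.1) (ω • testToL2 p.2),
    Lp.coeFn_smul ω (testToL2 p.2), testToL2_ae p.2, schrodinger_ae hM l p.1] with v h1 h2 h3 h4
  rw [h1, Pi.sub_apply, h2, Pi.smul_apply, h3, h4, smul_eq_mul]

variable {ω : ℂ} {a : ℝ} {w : ℂ} {φ φ' χ χ' : ℝ → ℂ}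

/-- The choice `p + ωf` for the second entry makes the first component of `(H - ω)(f, p + ωf)`
exactly `p`. Only an `L²` approximation is left, for the scalar equation with right side `q + ωp`.
-/
theorem exists_dist_schrodinger_lt (g : IsGreenPair (potential M l) ω a w φ φ' χ χ')
    (p q : testFun) {ε : ℝ} (hε : 0 < ε) : ∃ f : testFun,
    dist (testToL2 q) (schrodinger hM l f - ω • testToL2 (p + ω • f)) < ε := by
  have he := memLp_exp_neg_mul_abs g.pos
  obtain ⟨C, hC⟩ := exists_testFun_approx g (contDiff_potential hM l) (q + ω • p).2
  -- The `+ 1` avoids division by zero and makes the final inequality strict.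
  have hD : 0 < |C| * ‖he.toLp _‖ + 1 := by positivity
  obtain ⟨f, hf, hfε⟩ := hC (ε / (|C| * ‖he.toLp _‖ + 1)) (by positivity)
  refine ⟨⟨f, hf⟩, ?_⟩
  set f₀ : testFun := ⟨f, hf⟩
  have hae : ∀ᵐ u, ‖(testToL2 q - (schrodinger hM l f₀ - ω • testToL2 (p + ω • f₀)) :
      Lp ℂ 2 (volume : Measure ℝ)) u‖ ≤
      ε / (|C| * ‖he.toLp _‖ + 1) * |C| * ‖he.toLp _ u‖ := by
    filter_upwards [Lp.coeFn_sub (testToL2 q) (schrodinger hM l f₀ - ω • testToL2 (p + ω • f₀)),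
      Lp.coeFn_sub (schrodinger hM l f₀) (ω • testToL2 (p + ω • f₀)),
      Lp.coeFn_smul ω (testToL2 (p + ω • f₀)), testToL2_ae q, schrodinger_ae hM l f₀,
      testToL2_ae (p + ω • f₀), he.coeFn_toLp] with u h1 h2 h3 h4 h5 h6 h7
    have h6' : (p + ω • f₀).1 u = p.1 u + ω * f u := rfl
    have h8 := hfε u
    have h9 : (q + ω • p).1 u = q.1 u + ω * p.1 u := rfl
    rw [h9] at h8
    rw [h1, Pi.sub_apply, h2, Pi.sub_apply, h3, Pi.smul_apply, h4, h5, h6, h6', h7,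
      Real.norm_of_nonneg (Real.exp_pos _).le, ← norm_neg]
    calc _ = ‖-deriv (deriv f) u + ((potential M l u : ℂ) - ω ^ 2) * f u -
          (q.1 u + ω * p.1 u)‖ := by
          congr 1
          rw [smul_eq_mul]
          ring
      _ ≤ _ := h8
      _ ≤ _ := by
        rw [mul_assoc]
        gcongr
        exact le_abs_self C
  rw [dist_eq_norm]
  refine (Lp.norm_le_mul_norm_of_ae_le_mul hae).trans_lt ?_
  rw [mul_assoc, div_mul_eq_mul_div, div_lt_iff₀ hD]
  nlinarith

theorem denseRange_hamiltonianShift (g : IsGreenPair (potential M l) ω a w φ φ' χ χ') :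
    DenseRange (hamiltonianShift hM l ω) := by
  have key : range (testToEnergy hM l) ⊆ closure (range (hamiltonianShift hM l ω)) := by
    rintro _ ⟨⟨p, q⟩, rfl⟩
    refine Metric.mem_closure_iff.mpr fun ε hε => ?_
    obtain ⟨f, hf⟩ := exists_dist_schrodinger_lt hM l g p q hε
    refine ⟨_, mem_range_self (f, p + ω • f), ?_⟩
    have e : hamiltonianShift hM l ω (f, p + ω • f) = WithLp.toLp 2 (testToH1V0 hM l p,
        schrodinger hM l f - ω • testToL2 (p + ω • f)) := by
      rw [hamiltonianShift, add_sub_cancel_right]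
    rw [e]
    refine lt_of_eq_of_lt ?_ hf
    exact dist_toLp_mk_left (testToH1V0 hM l p) _ _
  exact dense_iff_closure_eq.mpr (eq_univ_of_univ_subset
    ((denseRange_testToEnergy hM l).closure_eq ▸ closure_minimal key isClosed_closure))

theorem exists_isResolventAt_hamiltonian (hω : ω.im ≠ 0)
    (g : IsGreenPair (potential M l) ω a w φ φ' χ χ') :
    ∃ R : EnergySpace hM l →L[ℂ] EnergySpace hM l, IsResolventAt (hamiltonian hM l) ω R := by
  have := completeSpace_energySpace hM l
  refine exists_isResolventAt_closure ?_ (isFormalAdjoint_hamiltonianMin hM l) hω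
    (range_hamiltonianMin_sub_smul hM l ω ▸ denseRange_hamiltonianShift hM l g)
  exact denseRange_testToEnergy hM l

/-! ### Convergence and continuity of the integral operator -/

theorem exists_integral_mul_fst_bound {k : ℝ → ℂ} (hk : Continuous k) {C : ℝ} (ha : 0 < a)
    (hC : ∀ v, ‖k v‖ ≤ C * Real.exp (-a * |v|)) :
    ∃ D, ∀ Ψ : EnergySpace hM l, Integrable (fun v => Ψ.fst.1.1.fst v * k v) ∧
      ‖∫ v, Ψ.fst.1.1.fst v * k v‖ ≤ D * ‖Ψ‖ := by
  obtain ⟨B, hB0, hB⟩ := exists_energySpace_bound hM l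
  refine ⟨∫ v, B * C * ((1 + |v|) * Real.exp (-a * |v|)), fun Ψ => ?_⟩
  have hi : Integrable fun v => B * C * ((1 + |v|) * Real.exp (-a * |v|)) * ‖Ψ‖ :=
    ((integrable_one_add_abs_mul_exp ha).const_mul _).mul_const _
  have hae : ∀ᵐ v, ‖Ψ.fst.1.1.fst v * k v‖ ≤
      B * C * ((1 + |v|) * Real.exp (-a * |v|)) * ‖Ψ‖ := by
    filter_upwards [hB Ψ] with v hv
    rw [norm_mul]
    calc _ ≤ B * (1 + |v|) * ‖Ψ‖ * (C * Real.exp (-a * |v|)) := by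
          gcongr
          exact hC v
      _ = _ := by ring
  refine ⟨hi.mono' ?_ hae, ?_⟩
  · exact (locallyIntegrable_of_Lp_potential hM l _).aestronglyMeasurable.mul
      hk.aestronglyMeasurable
  · rw [← integral_mul_const]
    exact norm_integral_le_of_norm_le hi hae

theorem memLp_of_exp_decay {k : ℝ → ℂ} (hk : Continuous k) {C : ℝ} (ha : 0 < a)
    (hC : ∀ v, ‖k v‖ ≤ C * Real.exp (-a * |v|)) : MemLp k 2 (volume : Measure ℝ) :=
  (memLp_exp_neg_mul_abs ha).of_le_mul (c := C) hk.aestronglyMeasurable (ae_of_all _ fun v => by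
    rw [Real.norm_of_nonneg (Real.exp_pos _).le]; exact hC v)

theorem integrable_greenFunction_mul (g : IsGreenPair (potential M l) ω a w φ φ' χ χ')
    (Ψ : EnergySpace hM l) (u : ℝ) :
    Integrable fun v => greenFunction φ χ w u v * (ω * Ψ.fst.1.1.fst v + Ψ.snd v) := by
  obtain ⟨C, hC⟩ := g.exists_greenFunction_bound u
  have hk := g.continuous_greenFunction u
  obtain ⟨D, hD⟩ := exists_integral_mul_fst_bound hM l hk g.pos hC
  have h2 : Integrable fun v => Ψ.snd v * greenFunction φ χ w u v :=
    (Lp.memLp Ψ.snd).integrable_mul (memLp_of_exp_decay hk g.pos hC)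
  refine (((hD Ψ).1.const_mul ω).add h2).congr (ae_of_all _ fun v => ?_)
  simp only [Pi.add_apply]
  ring

/-- The first component is paired through linear growth against exponential decay, the second
through `L²` duality. Continuity at each fixed `u` is enough to pass to limits pointwise. -/
theorem continuous_integral_greenFunction_mul
    (g : IsGreenPair (potential M l) ω a w φ φ' χ χ') (u : ℝ) :
    Continuous fun Ψ : EnergySpace hM l =>
      ∫ v, greenFunction φ χ w u v * (ω * Ψ.fst.1.1.fst v + Ψ.snd v) := by
  obtain ⟨C, hC⟩ := g.exists_greenFunction_bound u
  have hk := g.continuous_greenFunction u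
  have hk2 := memLp_of_exp_decay hk g.pos hC
  obtain ⟨D, hD⟩ := exists_integral_mul_fst_bound hM l hk g.pos hC
  have h1 : Continuous fun Ψ : EnergySpace hM l =>
      ∫ v, Ψ.fst.1.1.fst v * greenFunction φ χ w u v := by
    refine (LipschitzWith.of_dist_le_mul (K := D.toNNReal) fun x y => ?_).continuous
    have e : (∫ v, x.fst.1.1.fst v * greenFunction φ χ w u v) -
        ∫ v, y.fst.1.1.fst v * greenFunction φ χ w u v =
        ∫ v, (x - y).fst.1.1.fst v * greenFunction φ χ w u v := by
      rw [← integral_sub (hD x).1 (hD y).1]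
      refine integral_congr_ae ?_
      filter_upwards [(volume_absolutelyContinuous hM l).ae_le
        (Lp.coeFn_sub x.fst.1.1.fst y.fst.1.1.fst)] with v hv
      have hv' : (x - y).fst.1.1.fst v = x.fst.1.1.fst v - y.fst.1.1.fst v := hv
      rw [hv', sub_mul]
    rw [dist_eq_norm, e, dist_eq_norm]
    refine ((hD (x - y)).2).trans ?_
    gcongr
    exact Real.le_coe_toNNReal D
  have h2 := (continuous_integral_mul_Lp hk2).comp
    (WithLp.continuous_snd 2 (H1V0 hM l) (Lp ℂ 2 (volume : Measure ℝ)))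
  refine ((h1.const_mul ω).add h2).congr fun Ψ => ?_
  have h3 : Integrable fun v => Ψ.snd v * greenFunction φ χ w u v :=
    (Lp.memLp Ψ.snd).integrable_mul hk2
  change ω * (∫ v, Ψ.fst.1.1.fst v * greenFunction φ χ w u v) +
    ∫ v, Ψ.snd v * greenFunction φ χ w u v = _
  rw [← integral_const_mul, ← integral_add ((hD Ψ).1.const_mul ω) h3]
  congr 1
  funext v
  ring

/-- In `ω (g - ωf) + (-f'' + V f - ωg)` the terms `ωg` cancel, leaving the operator that the Green's
function inverts. -/
theorem integral_greenFunction_hamiltonianShift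
    (g : IsGreenPair (potential M l) ω a w φ φ' χ χ') (p : testFun × testFun) (u : ℝ) :
    ∫ v, greenFunction φ χ w u v * (ω * (hamiltonianShift hM l ω p).fst.1.1.fst v +
      (hamiltonianShift hM l ω p).snd v) = p.1.1 u := by
  rw [← g.integral_greenFunction_mul (continuous_potential hM l) p.1.2 u]
  refine integral_congr_ae ?_
  filter_upwards [hamiltonianShift_fst_ae hM l ω p, hamiltonianShift_snd_ae hM l ω p] with v h1 h2
  rw [h1, h2]
  ring

theorem resolvent_hamiltonianShift {R : EnergySpace hM l →L[ℂ] EnergySpace hM l}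
    (hR : IsResolventAt (hamiltonian hM l) ω R) (p : testFun × testFun) :
    R (hamiltonianShift hM l ω p) = testToEnergy hM l p := by
  have hx : testToEnergy hM l p ∈ (hamiltonianMin hM l).domain := LinearMap.mem_range_self _ _
  have h := IsResolventAt.apply_of_closure hR ⟨testToEnergy hM l p, hx⟩
  exact (congrArg R (hamiltonianMin_sub_smul hM l ω p hx)).symm.trans h

theorem resolvent_apply_ae (g : IsGreenPair (potential M l) ω a w φ φ' χ χ')
    {R : EnergySpace hM l →L[ℂ] EnergySpace hM l} (hR : IsResolventAt (hamiltonian hM l) ω R)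
    (Ψ : EnergySpace hM l) : ∀ᵐ u,
      (R Ψ).fst.1.1.fst u = ∫ v, greenFunction φ χ w u v * (ω * Ψ.fst.1.1.fst v + Ψ.snd v) ∧
      (R Ψ).snd u = Ψ.fst.1.1.fst u +
        ω * ∫ v, greenFunction φ χ w u v * (ω * Ψ.fst.1.1.fst v + Ψ.snd v) := by
  obtain ⟨y, hy, hyΨ⟩ := mem_closure_iff_seq_limit.mp (denseRange_hamiltonianShift hM l g Ψ)
  choose p hp using hy
  have hpΨ : Tendsto (fun n => hamiltonianShift hM l ω (p n)) atTop (𝓝 Ψ) := hyΨ.congr fun n =>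
    (hp n).symm
  have hRy : Tendsto (fun n => testToEnergy hM l (p n)) atTop (𝓝 (R Ψ)) :=
    ((R.continuous.tendsto Ψ).comp hpΨ).congr fun n => resolvent_hamiltonianShift hM l hR (p n)
  obtain ⟨ns, hns, hae⟩ := exists_subseq_eval_tendsto hM l hRy
  obtain ⟨ms, hms, hae'⟩ := exists_subseq_eval_tendsto hM l (hpΨ.comp hns.tendsto_atTop)
  filter_upwards [hae, hae', ae_all_iff.mpr fun n => testToEnergy_fst_ae hM l (p n),
    ae_all_iff.mpr fun n => testToEnergy_snd_ae hM l (p n),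
    ae_all_iff.mpr fun n => hamiltonianShift_fst_ae hM l ω (p n)] with u h1 h2 h3 h4 h5
  -- The integral converges at every `u` along the full sequence; subsequences are needed only to
  -- evaluate `L²` classes pointwise.
  have hlim : Tendsto (fun n => (p n).1.1 u) atTop
      (𝓝 (∫ v, greenFunction φ χ w u v * (ω * Ψ.fst.1.1.fst v + Ψ.snd v))) :=
    (((continuous_integral_greenFunction_mul hM l g u).tendsto Ψ).comp hpΨ).congr
      fun n => integral_greenFunction_hamiltonianShift hM l g (p n) u
  have l1 : Tendsto (fun n => (p (ns n)).1.1 u) atTop (𝓝 ((R Ψ).fst.1.1.fst u)) :=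
    h1.1.congr fun n => h3 (ns n)
  have l2 : Tendsto (fun n => (p (ns n)).2.1 u) atTop (𝓝 ((R Ψ).snd u)) :=
    h1.2.congr fun n => h4 (ns n)
  have l3 : Tendsto (fun n => (p (ns (ms n))).2.1 u - ω * (p (ns (ms n))).1.1 u) atTop
      (𝓝 (Ψ.fst.1.1.fst u)) := h2.1.congr fun n => h5 (ns (ms n))
  have hlim' := hlim.comp hns.tendsto_atTop
  refine ⟨tendsto_nhds_unique l1 hlim', ?_⟩
  -- The second entry is `g = (g - ωf) + ωf`: the first summand tends to `ψ₁`, the source of the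
  -- delta term, and the second to `ω` times the integral.
  refine tendsto_nhds_unique (l2.comp hms.tendsto_atTop)
    ((l3.add ((hlim'.comp hms.tendsto_atTop).const_mul ω)).congr fun n => ?_)
  exact sub_add_cancel _ _

theorem isIntegralOperatorWithKernel_resolvent
    (g : IsGreenPair (potential M l) ω a w φ φ' χ χ')
    {R : EnergySpace hM l →L[ℂ] EnergySpace hM l} (hR : IsResolventAt (hamiltonian hM l) ω R) :
    IsIntegralOperatorWithKernel R !![0, 0; 1, 0]
      (fun u v => greenFunction φ χ w u v • !![ω, 1; ω ^ 2, ω]) := by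
  intro Ψ
  -- The matrix has rank one, so a single scalar integral governs both components.
  have e : ∀ u v, (greenFunction φ χ w u v • !![ω, 1; ω ^ 2, ω]) *ᵥ Ψ.eval v =
      (greenFunction φ χ w u v * (ω * Ψ.fst.1.1.fst v + Ψ.snd v)) • ![1, ω] := fun u v => by
    ext i
    fin_cases i
    · simp [EnergySpace.eval, Matrix.mulVec, dotProduct, Fin.sum_univ_two]
      ring
    · simp [EnergySpace.eval, Matrix.mulVec, dotProduct, Fin.sum_univ_two]
      ring
  simp only [e]
  refine ⟨fun u => (integrable_greenFunction_mul hM l g Ψ u).smul_const _, ?_⟩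
  filter_upwards [resolvent_apply_ae hM l g hR Ψ] with u hu
  rw [integral_smul_const]
  ext i
  fin_cases i
  · simp [EnergySpace.eval, hu.1]
  · simp [EnergySpace.eval, hu.2]
    ring

end

end Schwarzschild

theorem mainTheorem8 (M : ℝ) (hM : 0 < M) (l : ℕ) (ω : ℂ) (hω : ω.im ≠ 0) :
    (∃! φ : ℝ → ℂ, Schwarzschild.IsJostAtBot M l ω φ) ∧
    (∃! χ : ℝ → ℂ, Schwarzschild.IsJostAtTop M l ω χ) ∧
    ∀ φ χ : ℝ → ℂ, Schwarzschild.IsJostAtBot M l ω φ → Schwarzschild.IsJostAtTop M l ω χ →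
      ∃ w : ℂ, w ≠ 0 ∧ (∀ u : ℝ, Schwarzschild.wronskian φ χ u = w) ∧
        ∃ R : Schwarzschild.EnergySpace hM l →L[ℂ] Schwarzschild.EnergySpace hM l,
          Schwarzschild.IsResolventAt (Schwarzschild.hamiltonian hM l) ω R ∧
          Schwarzschild.IsIntegralOperatorWithKernel R !![0, 0; 1, 0]
            (fun u v => Schwarzschild.greenFunction φ χ w u v • !![ω, 1; ω ^ 2, ω]) := by
  refine ⟨Schwarzschild.existsUnique_isJostAtBot hM l hω,
    Schwarzschild.existsUnique_isJostAtTop hM l hω, fun φ χ hφ hχ => ?_⟩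
  have g := Schwarzschild.isGreenPair_of_isJost hM l hω hφ hχ
  obtain ⟨R, hR⟩ := Schwarzschild.exists_isResolventAt_hamiltonian hM l hω g
  exact ⟨_, g.ne_zero, g.wronskian, R, hR,
    Schwarzschild.isIntegralOperatorWithKernel_resolvent hM l g hR⟩
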